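/- **Setting.** Let $k,q\ge 1$ and consider the plant $$\dot y=A_1y+\tilde g_1(y,z,u),\qquad \dot z=A_2z+B_2u+\tilde g_2(y,z,u),\qquad y\in\mathbb R^k,\ z\in\mathbb R^q,\ u\in\mathbb R^m,$$ with $\tilde g_1,\tilde g_2$ twice continuously differentiable and vanishing at the origin together with their first derivatives, and the feedback $K(y;z)=K_{11}z+K_{12}y+K_n(y)$ with $K_n$ continuously differentiable, $K_n(0)=0$ and $B_2\,DK_n(0)=0$. Assume that $A_K=A_2+B_2K_{11}$ has only eigenvalues with negative real part, let $E$ satisfy $A_KE-EA_1+B_2K_{12}=0$, and put $v=z-Ey$ and $K_1=[\,K_{12}+K_{11}E\;\;K_{11}\,]$. Let $h$ be a continuously differentiable local center manifold of the closed loop with $u=K(y;z)$, defined near $0\in\mathbb R^k$: $h(0)=0$, $Dh(0)=0$, and $v=h(y)$ is locally invariant. Put $w=v-h(y)$. Assume $A_1=0$ and that, for some $p>1$ and $k_5,k_6>0$, the function $g_1(y)=\tilde g_1(y,h(y)+Ey,K(y;h(y)+Ey))$ satisfies $\|g_1(y)\|\le k_5\|y\|^p$ and $y^\top g_1(y)\le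 -k_6\|y\|^{p+1}$ near $0$ (so $y=0$ is a locally asymptotically stable equilibrium of the reduced system $\dot y=g_1(y)$). Let $h^a$ be a polynomial map with $h(y)=h^a(y)+\mathcal O(\|y\|^s)$ for some $s>p$, and put $w^a=v-h^a(y)$. Let $P,Q\succ0$ satisfy $A_K^\top P+PA_K=-Q$, let $V(y,w)=\|y\|+\sqrt{w^\top Pw}$, $\alpha_1(r)=\min(1,\sqrt{\lambda_{\min}(P)})\,r$, $\alpha_2(r)=\sqrt2\max(1,\sqrt{\lambda_{\max}(P)})\,r$, and let $s_f\in(0,1)$ and $\sigma>0$ satisfy $$2\sigma\,\|PB_2K_1\|\sqrt{\lambda_{\max}(P)}\le(1-s_f)\,\lambda_{\min}(Q)\sqrt{\lambda_{\min}(P)} .$$ For $\delta,r_s>0$ let $\mathcal B_{r}=\{\|(y;w)\|\le r\}$, $S_v=\{\|(y;w)\|<\delta,\ V(y,w)\le\alpha_1(\delta)\}$ and $S_2=\{\|(y;w)\|<\alpha_2^{-1}(\alpha_1(r_s))\}$. **Implementation.** Let $t_1=\min\{t\ge t_0: (y(t);w(t))\in S_v\setminus S_2\}$ and, for $i\ge1$,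 $$t_{i+1}=\min\{t\ge t_i:\ \|e(t)\|\ge\sigma(\|w^a(t)\|+\|y(t)\|^{p+1})\ \text{and}\ (y(t);w(t))\in S_v\setminus S_2\},$$ where $e(t)=(y(t_i)-y(t);\,v(t_i)-v(t))$ on $[t_i,t_{i+1})$ (an event time is $\infty$ if there is no such $t$). The input is $u=0$ on $[t_0,t_1)$ and $u=K(y(t_i);z(t_i))$ on $[t_i,t_{i+1})$, $i\ge1$. **Claim.** There are $\delta_0>0$ and $c_y,c_w>0$ such that for every $\delta\in(0,\delta_0]$: 1. Whenever $\|(y;w)\|<\delta$ and $\|e\|\le\sigma(\|w^a\|+\|y\|^{p+1})$, one has $\zeta^\top(\dot y;\dot w)\le -c_y\|y\|^p-c_w\|w\|$ for all $\zeta\in\partial V(y,w)$, where $(\dot y;\dot w)$ is the closed-loop vector field with measurement error $e$. In particular $S_v$ is a sub-level set of $V$ on which this decrease holds. 2. For every $r_s>0$ with $\mathcal B_{r_s}\subset S_v$: from every initial state in $S_v$, at every initial time $t_0$, there is a trajectory of the event-triggered closed loop on $[t_0,\infty)$; and there are $T_b\ge0$ and $\tau>0$, independent of $t_0$ and of the trajectory,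 such that every trajectory with initial state in $S_v$, on any interval $[t_0,T)$ with $T\le\infty$ not extending beyond an accumulation point of events, stays in $S_v$, lies in $\mathcal B_{r_s}$ for all $t\ge t_0+T_b$ (local ultimate boundedness by $\mathcal B_{r_s}$), and satisfies $t_{i+1}-t_i\ge\tau$ for all $i\ge1$ (for all events that occur). -/

import Mathlib

open Set Filter Topology Asymptotics

noncomputable section

namespace EventCenter

/-- Real Euclidean space of dimension `n`. -/
abbrev Vec (n : ℕ) : Type := EuclideanSpace ℝ (Fin n)

/-- The action `M x` of a real matrix on a Euclidean vector. -/
def act {a b : ℕ} (M : Matrix (Fin a) (Fin b) ℝ) (x : Vec b) : Vec a :=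
  Matrix.toEuclideanLin M x

/-- The Euclidean norm of the concatenated vector `(a; b)`. -/
def pairNorm {a b : ℕ} (x : Vec a) (y : Vec b) : ℝ := √(‖x‖ ^ 2 + ‖y‖ ^ 2)

/-- The norm of a (rectangular) matrix induced by the Euclidean norms. -/
def opNorm {ι κ : Type*} [Fintype ι] [Fintype κ] [DecidableEq κ] (M : Matrix ι κ ℝ) : ℝ :=
  ‖LinearMap.toContinuousLinearMap (Matrix.toEuclideanLin M)‖

/-- Smallest eigenvalue of a symmetric matrix. -/
def lambdaMin {n : ℕ} (M : Matrix (Fin n) (Fin n) ℝ) : ℝ := sInf (spectrum ℝ M)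

/-- Largest eigenvalue of a symmetric matrix. -/
def lambdaMax {n : ℕ} (M : Matrix (Fin n) (Fin n) ℝ) : ℝ := sSup (spectrum ℝ M)

/-! ### The plant and the controller -/

/-- The plant
`y' = A₁ y + g₁(y, z, u)`, `z' = A₂ z + B₂ u + g₂(y, z, u)`
with twice continuously differentiable nonlinearities which vanish at the origin together
with all their first derivatives. -/
structure Plant (k q m : ℕ) where
  A₁ : Matrix (Fin k) (Fin k) ℝ
  A₂ : Matrix (Fin q) (Fin q) ℝ
  B₂ : Matrix (Fin q) (Fin m) ℝ
  g₁ : Vec k × Vec q × Vec m → Vec k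
  g₂ : Vec k × Vec q × Vec m → Vec q
  g₁_contDiff : ContDiff ℝ 2 g₁
  g₂_contDiff : ContDiff ℝ 2 g₂
  g₁_zero : g₁ 0 = 0
  g₂_zero : g₂ 0 = 0
  g₁_deriv : fderiv ℝ g₁ 0 = 0
  g₂_deriv : fderiv ℝ g₂ 0 = 0

/-- The feedback `K(y; z) = K₁₁ z + K₁₂ y + Kₙ(y)` with a continuously differentiable `Kₙ`
vanishing at the origin. -/
structure Feedback (k q m : ℕ) where
  K₁₁ : Matrix (Fin m) (Fin q) ℝ
  K₁₂ : Matrix (Fin m) (Fin k) ℝ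
  Kn : Vec k → Vec m
  Kn_contDiff : ContDiff ℝ 1 Kn
  Kn_zero : Kn 0 = 0

variable {k q m : ℕ}

/-- Right-hand side of the `y` equation of the plant. -/
def Plant.yField (S : Plant k q m) (y : Vec k) (z : Vec q) (u : Vec m) : Vec k :=
  act S.A₁ y + S.g₁ (y, z, u)

/-- Right-hand side of the `z` equation of the plant. -/
def Plant.zField (S : Plant k q m) (y : Vec k) (z : Vec q) (u : Vec m) : Vec q :=
  act S.A₂ z + act S.B₂ u + S.g₂ (y, z, u)

/-- The control law `u = K(y; z)`. -/
def Feedback.law (K : Feedback k q m) (y : Vec k) (z : Vec q) : Vec m :=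
  act K.K₁₁ z + act K.K₁₂ y + K.Kn y

/-- The matrix `A_K = A₂ + B₂ K₁₁`. -/
def AK (S : Plant k q m) (K : Feedback k q m) : Matrix (Fin q) (Fin q) ℝ :=
  S.A₂ + S.B₂ * K.K₁₁

/-- The matrix `K₁ = [K₁₂ + K₁₁ E, K₁₁]`, which acts on the error `(e_y; e_v)`. -/
def K1 (K : Feedback k q m) (E : Matrix (Fin q) (Fin k) ℝ) :
    Matrix (Fin m) (Fin k ⊕ Fin q) ℝ :=
  Matrix.fromCols (K.K₁₂ + K.K₁₁ * E) K.K₁₁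

/-! ### The closed loop in the coordinates `v = z - E y` and its center manifolds -/

/-- `y'` at the state `(y, v)` when the control is computed from the measurement
`(y + e_y, v + e_v)`. -/
def yRate (S : Plant k q m) (K : Feedback k q m) (E : Matrix (Fin q) (Fin k) ℝ)
    (y : Vec k) (v : Vec q) (ey : Vec k) (ev : Vec q) : Vec k :=
  S.yField y (v + act E y) (K.law (y + ey) (v + ev + act E (y + ey)))

/-- `v' = z' - E y'` at the state `(y, v)` when the control is computed from the measurement
`(y + e_y, v + e_v)`. -/
def vRate (S : Plant k q m) (K : Feedback k q m) (E : Matrix (Fin q) (Fin k) ℝ)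
    (y : Vec k) (v : Vec q) (ey : Vec k) (ev : Vec q) : Vec q :=
  S.zField y (v + act E y) (K.law (y + ey) (v + ev + act E (y + ey)))
    - act E (yRate S K E y v ey ev)

/-- `w'` for `w = v - h(y)`, at the state `(y, w)` and with measurement error `(e_y, e_v)`. -/
def wRate (S : Plant k q m) (K : Feedback k q m) (E : Matrix (Fin q) (Fin k) ℝ)
    (h : Vec k → Vec q) (y : Vec k) (w : Vec q) (ey : Vec k) (ev : Vec q) : Vec q :=
  vRate S K E y (w + h y) ey ev - fderiv ℝ h y (yRate S K E y (w + h y) ey ev)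

/-- `v = h(y)`, with `h` considered on the open ball of radius `ρ`, is a (local) center manifold
of the closed loop without measurement error: `h` is continuously differentiable,
`h(0) = 0`, `Dh(0) = 0`, and a solution which starts on the graph of `h` stays on it as long as
its `y` component is in the ball. -/
structure IsCenterManifold (S : Plant k q m) (K : Feedback k q m)
    (E : Matrix (Fin q) (Fin k) ℝ) (h : Vec k → Vec q) (ρ : ℝ) : Prop where
  radius_pos : 0 < ρ
  contDiffOn : ContDiffOn ℝ 1 h (Metric.ball 0 ρ)
  zero : h 0 = 0
  deriv_zero : fderiv ℝ h 0 = 0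
  invariant : ∀ (T : ℝ) (y : ℝ → Vec k) (v : ℝ → Vec q), 0 < T →
    (∀ t ∈ Ico 0 T, y t ∈ Metric.ball (0 : Vec k) ρ) →
    (∀ t ∈ Ico 0 T, HasDerivWithinAt y (yRate S K E (y t) (v t) 0 0) (Ico 0 T) t) →
    (∀ t ∈ Ico 0 T, HasDerivWithinAt v (vRate S K E (y t) (v t) 0 0) (Ico 0 T) t) →
    v 0 = h (y 0) →
    ∀ t ∈ Ico 0 T, v t = h (y t)

/-- The nonlinearity of the reduced system: `g₁(y, h(y) + E y, K(y; h(y) + E y))`. -/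
def reducedG₁ (S : Plant k q m) (K : Feedback k q m) (E : Matrix (Fin q) (Fin k) ℝ)
    (h : Vec k → Vec q) (y : Vec k) : Vec k :=
  S.g₁ (y, h y + act E y, K.law y (h y + act E y))

/-- The polynomial map with the given components. -/
def polyMap (H : Fin q → MvPolynomial (Fin k) ℝ) (y : Vec k) : Vec q :=
  WithLp.toLp 2 fun j => MvPolynomial.eval (fun i => y i) (H j)

/-! ### The Lyapunov function and the sets built from it -/

/-- `V(y, w) = ‖y‖ + √(wᵀ P w)`. -/
def lyap (P : Matrix (Fin q) (Fin q) ℝ) (y : Vec k) (w : Vec q) : ℝ :=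
  ‖y‖ + √(inner ℝ w (act P w))

/-- The subdifferential of the convex function `V` at `(y, w)`. -/
def lyapSubdiff (P : Matrix (Fin q) (Fin q) ℝ) (y : Vec k) (w : Vec q) :
    Set (Vec k × Vec q) :=
  {ζ | ∀ (y' : Vec k) (w' : Vec q),
    lyap P y w + inner ℝ ζ.1 (y' - y) + inner ℝ ζ.2 (w' - w) ≤ lyap P y' w'}

/-- The slope of `α₁(r) = min(1, √λ_min(P)) r`. -/
def slope₁ (P : Matrix (Fin q) (Fin q) ℝ) : ℝ := min 1 √(lambdaMin P)

/-- The slope of `α₂(r) = √2 max(1, √λ_max(P)) r`. -/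
def slope₂ (P : Matrix (Fin q) (Fin q) ℝ) : ℝ := √2 * max 1 √(lambdaMax P)

/-- The closed ball of radius `r` in the `(y; w)` space. -/
def ballYW (k q : ℕ) (r : ℝ) : Set (Vec k × Vec q) := {x | pairNorm x.1 x.2 ≤ r}

/-- `S_v = {(y; w) : ‖(y; w)‖ < δ, V(y, w) ≤ α₁(δ)}`. -/
def Sv (k : ℕ) {q : ℕ} (P : Matrix (Fin q) (Fin q) ℝ) (δ : ℝ) : Set (Vec k × Vec q) :=
  {x | pairNorm x.1 x.2 < δ ∧ lyap P x.1 x.2 ≤ slope₁ P * δ}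

/-- `S₂ = {(y; w) : ‖(y; w)‖ < α₂⁻¹(α₁(r_s))}`. -/
def S2 (k : ℕ) {q : ℕ} (P : Matrix (Fin q) (Fin q) ℝ) (rs : ℝ) : Set (Vec k × Vec q) :=
  {x | pairNorm x.1 x.2 < slope₁ P * rs / slope₂ P}

/-- On `‖(y; w)‖ < δ` the derivative of `V` along the closed loop is at most
`-(c_y ‖y‖ ^ p + c_w ‖w‖)` whenever the measurement error satisfies
`‖e‖ ≤ σ (‖wᵃ‖ + ‖y‖ ^ (p + 1))`, where `wᵃ = v - hᵃ(y)`. -/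
def DecreasesOn (S : Plant k q m) (K : Feedback k q m) (E : Matrix (Fin q) (Fin k) ℝ)
    (h ha : Vec k → Vec q) (P : Matrix (Fin q) (Fin q) ℝ) (σ p cy cw δ : ℝ) : Prop :=
  ∀ (y : Vec k) (w : Vec q) (ey : Vec k) (ev : Vec q), pairNorm y w < δ →
    pairNorm ey ev ≤ σ * (‖w + h y - ha y‖ + ‖y‖ ^ (p + 1)) →
    ∀ ζ ∈ lyapSubdiff P y w,
      inner ℝ ζ.1 (yRate S K E y (w + h y) ey ev) + inner ℝ ζ.2 (wRate S K E h y w ey ev)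
        ≤ -(cy * ‖y‖ ^ p + cw * ‖w‖)

/-! ### The event-triggered closed loop -/

/-- `a` is the first element of the set of times `D`, and `⊤` when there is none. -/
def IsFirstTime (D : Set ℝ) (a : EReal) : Prop :=
  (∃ r : ℝ, IsLeast D r ∧ a = (r : EReal)) ∨ (D = ∅ ∧ a = ⊤)

/-- The point `(y; w)` which belongs to the plant state `(y, z)`; here `w = z - E y - h(y)`. -/
def toYW (E : Matrix (Fin q) (Fin k) ℝ) (h : Vec k → Vec q) (y : Vec k) (z : Vec q) :
    Vec k × Vec q :=
  (y, z - act E y - h y)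

/-- At time `t` the signals `y`, `z` follow the plant equations with the input value `u`
(right derivatives, since the input is right-continuous and jumps at the events). -/
def FollowsAt (S : Plant k q m) (y : ℝ → Vec k) (z : ℝ → Vec q) (t : ℝ) (u : Vec m) : Prop :=
  HasDerivWithinAt y (S.yField (y t) (z t) u) (Ici t) t ∧
    HasDerivWithinAt z (S.zField (y t) (z t) u) (Ici t) t

/-- The triggering inequality at time `t` when the last event was at time `s`:
`‖e‖ ≥ σ (‖wᵃ‖ + ‖y‖ ^ (p + 1))` with `e = (y(s) - y(t); v(s) - v(t))`, `v = z - E y` and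
`wᵃ = v - hᵃ(y)`. -/
def Triggers (E : Matrix (Fin q) (Fin k) ℝ) (ha : Vec k → Vec q) (σ p : ℝ)
    (y : ℝ → Vec k) (z : ℝ → Vec q) (s t : ℝ) : Prop :=
  σ * (‖z t - act E (y t) - ha (y t)‖ + ‖y t‖ ^ (p + 1)) ≤
    pairNorm (y s - y t) ((z s - act E (y s)) - (z t - act E (y t)))

/-- `(y, z)` with event times `τ 1 ≤ τ 2 ≤ …` (`⊤` for events that do not happen, `τ 0 = t₀`)
is a trajectory on `[t₀, T)`, `T ≤ ∞`, of the event-triggered closed loop: the input is `0` before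
`τ 1` and is held at `K(y(τ i); z(τ i))` on `[τ i, τ (i + 1))`; the first event is the first time
in the set `D`, and each later one is the first time at which the triggering inequality holds
in the set `D`. The interval `[t₀, T)` may end at, but not extend beyond, an accumulation point
of events. -/
structure IsTrajectory (S : Plant k q m) (K : Feedback k q m) (E : Matrix (Fin q) (Fin k) ℝ)
    (h ha : Vec k → Vec q) (σ p : ℝ) (D : Set (Vec k × Vec q)) (t₀ : ℝ) (T : EReal)
    (y : ℝ → Vec k) (z : ℝ → Vec q) (τ : ℕ → EReal) : Prop where
  y_cont : ContinuousOn y {t : ℝ | t₀ ≤ t ∧ (t : EReal) < T}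
  z_cont : ContinuousOn z {t : ℝ | t₀ ≤ t ∧ (t : EReal) < T}
  start : τ 0 = (t₀ : EReal)
  first_event : IsFirstTime {t : ℝ | t₀ ≤ t ∧ (t : EReal) < T ∧ toYW E h (y t) (z t) ∈ D} (τ 1)
  next_event : ∀ i : ℕ, 1 ≤ i →
    IsFirstTime {t : ℝ | τ i ≤ (t : EReal) ∧ (t : EReal) < T ∧
      Triggers E ha σ p y z (τ i).toReal t ∧ toYW E h (y t) (z t) ∈ D} (τ (i + 1))
  zero_input : ∀ t : ℝ, t₀ ≤ t → (t : EReal) < T → (t : EReal) < τ 1 → FollowsAt S y z t 0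
  held_input : ∀ i : ℕ, 1 ≤ i → ∀ t : ℝ, τ i ≤ (t : EReal) → (t : EReal) < T →
    (t : EReal) < τ (i + 1) →
    FollowsAt S y z t (K.law (y (τ i).toReal) (z (τ i).toReal))
  exhausts : ∀ t : ℝ, t₀ ≤ t → (t : EReal) < T → ∃ i : ℕ, (t : EReal) < τ i

end EventCenter

end

/-! In the coordinates `(y, w)` the invariance equation of the center manifold makes `w'` vanish for
`w = 0`, `e = 0`. The nonlinear remainders have zero strict derivative at the origin, so passing
from `(y, h(y), 0)` to `(y, w + h(y), e)` changes them by at most `ε (‖w‖ + ‖e‖)`, with no term in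
`y` alone. Hence, near the origin, `y' = g₁(y)` and `w' = A_K w + B₂ K₁ e` up to such errors
(`exists_rate_bounds`).

Since `s > p`, the triggering bound gives `‖e‖ ≤ σ ‖w‖ + η ‖y‖ ^ p` with `η` as small as desired. As
`V` is homogeneous of degree one, the `y` part of its derivative supplies `-k₆ ‖y‖ ^ p` and the `w`
part supplies linear decay in `‖w‖`. The condition on `σ` reserves the fraction `s_f` of that decay;
this reserve and half of `k₆` absorb all small terms (`exists_decreasesOn`).

Along a trajectory the right derivative of `V` is given by a subgradient. In `S_v \ S₂` the absence
of an event is exactly the error bound, so `V` falls at a uniform rate. In `S₂` nothing is known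
about the input, but there `V < α₁(r_s)`. Comparing `V` with the maximum of a decreasing affine
function and `α₁(r_s)` yields invariance and ultimate boundedness (`lyap_le_of_driven`).

For the time between events, the error starts at zero and grows at a bounded rate, while the
threshold is bounded below on `S_v \ S₂` by compactness (`exists_gap`). Trajectories exist because
solutions for constant inputs, obtained from a cut-off field, can be concatenated at the events, and
the gap rules out accumulation (`exists_trajectory`). -/

namespace EventCenter

/-! ### Matrices acting on Euclidean vectors -/

/-- The action of a matrix as a continuous linear map. -/
noncomputable def actL {a b : ℕ} (M : Matrix (Fin a) (Fin b) ℝ) : Vec b →L[ℝ] Vec a :=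
  LinearMap.toContinuousLinearMap (Matrix.toEuclideanLin M)

theorem act_eq_actL {a b : ℕ} (M : Matrix (Fin a) (Fin b) ℝ) (x : Vec b) :
    act M x = actL M x := rfl

theorem act_add {a b : ℕ} (M : Matrix (Fin a) (Fin b) ℝ) (x y : Vec b) :
    act M (x + y) = act M x + act M y := map_add (actL M) x y

theorem act_sub {a b : ℕ} (M : Matrix (Fin a) (Fin b) ℝ) (x y : Vec b) :
    act M (x - y) = act M x - act M y := map_sub (actL M) x y

theorem act_smul {a b : ℕ} (M : Matrix (Fin a) (Fin b) ℝ) (c : ℝ) (x : Vec b) :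
    act M (c • x) = c • act M x := map_smul (actL M) c x

@[simp]
theorem act_zero {a b : ℕ} (M : Matrix (Fin a) (Fin b) ℝ) : act M 0 = 0 := map_zero (actL M)

theorem continuous_act {a b : ℕ} (M : Matrix (Fin a) (Fin b) ℝ) : Continuous (act M) :=
  (actL M).continuous

theorem add_act {a b : ℕ} (M N : Matrix (Fin a) (Fin b) ℝ) (x : Vec b) :
    act (M + N) x = act M x + act N x := by
  simp [act]

theorem sub_act {a b : ℕ} (M N : Matrix (Fin a) (Fin b) ℝ) (x : Vec b) :
    act (M - N) x = act M x - act N x := by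
  simp [act]

theorem neg_act {a b : ℕ} (M : Matrix (Fin a) (Fin b) ℝ) (x : Vec b) :
    act (-M) x = -act M x := by
  simp [act]

@[simp]
theorem zero_act {a b : ℕ} (x : Vec b) : act (0 : Matrix (Fin a) (Fin b) ℝ) x = 0 := by
  simp [act]

@[simp]
theorem one_act {a : ℕ} (x : Vec a) : act (1 : Matrix (Fin a) (Fin a) ℝ) x = x := by
  ext i; simp [act]

theorem mul_act {a b c : ℕ} (M : Matrix (Fin a) (Fin b) ℝ) (N : Matrix (Fin b) (Fin c) ℝ)
    (x : Vec c) : act (M * N) x = act M (act N x) := by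
  ext i; simp [act, Matrix.toLpLin_apply]

theorem inner_act {a b : ℕ} (M : Matrix (Fin a) (Fin b) ℝ) (x : Vec a) (y : Vec b) :
    inner ℝ x (act M y) = inner ℝ (act M.transpose x) y := by
  simp only [act, Matrix.toLpLin_apply, EuclideanSpace.inner_eq_star_dotProduct]
  simp only [star_trivial, Matrix.mulVec_transpose]
  rw [dotProduct_comm, Matrix.dotProduct_mulVec, dotProduct_comm]

theorem inner_act_eq_dotProduct {n : ℕ} (M : Matrix (Fin n) (Fin n) ℝ) (x : Vec n) :
    inner ℝ x (act M x) = star x.ofLp ⬝ᵥ (M.mulVec x.ofLp) := by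
  simp only [act, Matrix.toLpLin_apply, EuclideanSpace.inner_eq_star_dotProduct]
  rw [dotProduct_comm]

/-- Subtracting `c` shifts the spectrum to nonnegative numbers, so `M - c` is positive semidefinite.
-/
theorem le_inner_act_of_spectrum {n : ℕ} {M : Matrix (Fin n) (Fin n) ℝ}
    (hM : M.IsHermitian) {c : ℝ} (hc : ∀ μ ∈ spectrum ℝ M, c ≤ μ) (x : Vec n) :
    c * ‖x‖ ^ 2 ≤ inner ℝ x (act M x) := by
  have hH : (M - algebraMap ℝ _ c).IsHermitian := by
    apply hM.sub
    simp [Matrix.algebraMap_eq_diagonal]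
  have hps : (M - algebraMap ℝ _ c).PosSemidef := by
    rw [hH.posSemidef_iff_eigenvalues_nonneg]
    intro i
    have h1 := hH.eigenvalues_mem_spectrum_real i
    have h2 : hH.eigenvalues i + c ∈ spectrum ℝ M := by
      have := (spectrum.add_mem_add_iff (R := ℝ) (a := M - algebraMap ℝ _ c)
        (r := hH.eigenvalues i) (s := c)).2 h1
      simpa using this
    have := hc _ h2
    simp only [Pi.zero_apply]
    linarith
  have h3 := hps.re_dotProduct_nonneg x.ofLp
  have h4 : inner ℝ x (act (M - algebraMap ℝ _ c) x) = inner ℝ x (act M x) - c * ‖x‖ ^ 2 := by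
    rw [sub_act, inner_sub_right, Algebra.algebraMap_eq_smul_one]
    have : act (c • (1 : Matrix (Fin n) (Fin n) ℝ)) x = c • x := by
      rw [← one_act (c • x), act_smul]; simp [act]
    rw [this, inner_smul_right, real_inner_self_eq_norm_sq]
  rw [← inner_act_eq_dotProduct] at h3
  simp only [RCLike.re_to_real] at h3
  linarith

theorem inner_act_le_of_spectrum {n : ℕ} {M : Matrix (Fin n) (Fin n) ℝ}
    (hM : M.IsHermitian) {c : ℝ} (hc : ∀ μ ∈ spectrum ℝ M, μ ≤ c) (x : Vec n) :
    inner ℝ x (act M x) ≤ c * ‖x‖ ^ 2 := by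
  have := le_inner_act_of_spectrum hM.neg (c := -c) (fun μ hμ => by
    rw [← spectrum.neg_eq] at hμ
    have := hc _ (Set.mem_neg.1 hμ)
    linarith) x
  rw [neg_act, inner_neg_right] at this
  linarith

/-! ### Extreme eigenvalues and the norm of a positive definite matrix -/

section PosDef

variable {n : ℕ} {M : Matrix (Fin n) (Fin n) ℝ}

theorem lambdaMin_mul_le (hM : M.IsHermitian) (x : Vec n) :
    lambdaMin M * ‖x‖ ^ 2 ≤ inner ℝ x (act M x) :=
  le_inner_act_of_spectrum hM
    (fun _ hμ => csInf_le M.finite_real_spectrum.bddBelow hμ) x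

theorem le_lambdaMax_mul (hM : M.IsHermitian) (x : Vec n) :
    inner ℝ x (act M x) ≤ lambdaMax M * ‖x‖ ^ 2 :=
  inner_act_le_of_spectrum hM
    (fun _ hμ => le_csSup M.finite_real_spectrum.bddAbove hμ) x

theorem spectrum_nonempty (hn : 0 < n) (hM : M.IsHermitian) : (spectrum ℝ M).Nonempty :=
  ⟨_, hM.eigenvalues_mem_spectrum_real ⟨0, hn⟩⟩

theorem spectrum_pos (hM : M.PosDef) {μ : ℝ} (hμ : μ ∈ spectrum ℝ M) : 0 < μ := by
  rw [hM.1.spectrum_real_eq_range_eigenvalues] at hμ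
  obtain ⟨i, rfl⟩ := hμ
  exact hM.eigenvalues_pos i

/-- The finite nonempty spectrum attains its infimum; for `n = 0` the value would be `sInf ∅ = 0`.
-/
theorem lambdaMin_pos (hn : 0 < n) (hM : M.PosDef) : 0 < lambdaMin M :=
  spectrum_pos hM ((spectrum_nonempty hn hM.1).csInf_mem M.finite_real_spectrum)

theorem lambdaMax_pos (hn : 0 < n) (hM : M.PosDef) : 0 < lambdaMax M :=
  spectrum_pos hM ((spectrum_nonempty hn hM.1).csSup_mem M.finite_real_spectrum)

/-- The norm `√(xᵀ M x)`. -/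
noncomputable def wnorm (M : Matrix (Fin n) (Fin n) ℝ) (x : Vec n) : ℝ := √(inner ℝ x (act M x))

theorem inner_act_nonneg (hM : M.PosDef) (x : Vec n) : 0 ≤ inner ℝ x (act M x) := by
  rw [inner_act_eq_dotProduct]
  simpa using hM.posSemidef.re_dotProduct_nonneg x.ofLp

theorem inner_act_comm (hM : M.IsHermitian) (x y : Vec n) :
    inner ℝ x (act M y) = inner ℝ y (act M x) := by
  rw [inner_act, real_inner_comm, show M.transpose = M by simpa using hM.eq]

theorem wnorm_nonneg (x : Vec n) : 0 ≤ wnorm M x := Real.sqrt_nonneg _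

theorem wnorm_sq (hM : M.PosDef) (x : Vec n) : wnorm M x ^ 2 = inner ℝ x (act M x) :=
  Real.sq_sqrt (inner_act_nonneg hM x)

@[simp]
theorem wnorm_zero : wnorm M (0 : Vec n) = 0 := by simp [wnorm]

theorem wnorm_pos (hM : M.PosDef) {x : Vec n} (hx : x ≠ 0) : 0 < wnorm M x := by
  apply Real.sqrt_pos.2
  rw [inner_act_eq_dotProduct]
  have := hM.re_dotProduct_pos (x := x.ofLp) (by simpa using hx)
  simpa using this

theorem wnorm_one (x : Vec n) : wnorm (1 : Matrix (Fin n) (Fin n) ℝ) x = ‖x‖ := by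
  simp [wnorm]

theorem wnorm_smul {c : ℝ} (hc : 0 ≤ c) (x : Vec n) : wnorm M (c • x) = c * wnorm M x := by
  rw [wnorm, act_smul, inner_smul_left, inner_smul_right, ← mul_assoc,
    Real.sqrt_mul (by positivity), wnorm]
  simp [Real.sqrt_mul_self hc]

theorem continuous_wnorm : Continuous (wnorm M) :=
  (continuous_id.inner (continuous_act M)).sqrt

theorem wnorm_le (hn : 0 < n) (hM : M.PosDef) (x : Vec n) :
    wnorm M x ≤ √(lambdaMax M) * ‖x‖ := by
  rw [← Real.sqrt_sq (norm_nonneg x), ← Real.sqrt_mul (lambdaMax_pos hn hM).le]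
  exact Real.sqrt_le_sqrt (le_lambdaMax_mul hM.1 x)

theorem le_wnorm (hn : 0 < n) (hM : M.PosDef) (x : Vec n) :
    √(lambdaMin M) * ‖x‖ ≤ wnorm M x := by
  rw [← Real.sqrt_sq (norm_nonneg x), ← Real.sqrt_mul (lambdaMin_pos hn hM).le]
  exact Real.sqrt_le_sqrt (lambdaMin_mul_le hM.1 x)

theorem wnorm_add_sq (hM : M.PosDef) (x d : Vec n) :
    wnorm M (x + d) ^ 2 = wnorm M x ^ 2 + 2 * inner ℝ d (act M x) + wnorm M d ^ 2 := by
  simp only [wnorm_sq hM, act_add, inner_add_left, inner_add_right]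
  rw [inner_act_comm hM.1 x d]; ring

/-- The Cauchy-Schwarz inequality for the inner product given by `M`. -/
theorem inner_act_le_wnorm (hM : M.PosDef) (x d : Vec n) :
    inner ℝ d (act M x) ≤ wnorm M x * wnorm M d := by
  by_cases hx : x = 0
  · simp [hx]
  have h0 := wnorm_pos hM hx
  by_cases hd : d = 0
  · simp [hd]
  have h1 := wnorm_pos hM hd
  -- With `a = wnorm M x` and `b = wnorm M d`, this square expands to `2ab (ab - ⟪d, M x⟫)`.
  have h2 : 0 ≤ inner ℝ (wnorm M d • x - wnorm M x • d)
      (act M (wnorm M d • x - wnorm M x • d)) := inner_act_nonneg hM _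
  simp only [act_sub, act_smul, inner_sub_left, inner_sub_right, inner_smul_left,
    inner_smul_right, ← wnorm_sq hM, inner_act_comm hM.1 x d] at h2
  simp only [conj_trivial] at h2
  have h3 : 0 ≤ 2 * (wnorm M x * wnorm M d) * (wnorm M x * wnorm M d - inner ℝ d (act M x)) := by
    nlinarith
  have h4 : 0 < 2 * (wnorm M x * wnorm M d) := by positivity
  have := nonneg_of_mul_nonneg_right h3 h4
  linarith

/-- A subgradient `ζ` of `wnorm M` at `x`, tested against a direction. -/
theorem inner_le_of_subgradient (hM : M.PosDef) {x ζ : Vec n}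
    (hζ : ∀ x', wnorm M x + inner ℝ ζ (x' - x) ≤ wnorm M x') (hx : x ≠ 0) (d : Vec n) :
    inner ℝ ζ d ≤ inner ℝ d (act M x) / wnorm M x := by
  have h0 := wnorm_pos hM hx
  apply le_of_forall_pos_le_add
  intro ε hε
  obtain ⟨t, ht, hte⟩ : ∃ t > 0, t * (wnorm M d ^ 2 / (2 * wnorm M x)) ≤ ε := by
    refine ⟨ε / (wnorm M d ^ 2 / (2 * wnorm M x) + 1), by positivity, ?_⟩
    rw [div_mul_eq_mul_div, div_le_iff₀ (by positivity)]
    nlinarith [hε]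
  have h1 := hζ (x + t • d)
  rw [add_sub_cancel_left, inner_smul_right] at h1
  have h2 := wnorm_add_sq hM x (t • d)
  rw [wnorm_smul ht.le, inner_smul_left, conj_trivial] at h2
  set I := inner ℝ d (act M x)
  -- Concavity of the square root: `√B - √A ≤ (B - A) / (2 √A)`.
  have h3 : wnorm M (x + t • d) ≤
      wnorm M x + (2 * (t * I) + (t * wnorm M d) ^ 2) / (2 * wnorm M x) := by
    have : (2 * (t * I) + (t * wnorm M d) ^ 2) / (2 * wnorm M x) =
      (wnorm M (x + t • d) ^ 2 - wnorm M x ^ 2) / (2 * wnorm M x) := by rw [h2]; ring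
    rw [this, ← sub_le_iff_le_add', le_div_iff₀ (by positivity)]
    nlinarith [sq_nonneg (wnorm M (x + t • d) - wnorm M x)]
  have h4 : t * inner ℝ ζ d ≤ t * (I / wnorm M x + t * (wnorm M d ^ 2 / (2 * wnorm M x))) := by
    have : t * (I / wnorm M x + t * (wnorm M d ^ 2 / (2 * wnorm M x)))
        = (2 * (t * I) + (t * wnorm M d) ^ 2) / (2 * wnorm M x) := by
      field_simp
    rw [this]; linarith
  have := le_of_mul_le_mul_left h4 ht
  linarith

theorem inner_le_of_subgradient_zero {ζ : Vec n}
    (hζ : ∀ x', wnorm M (0 : Vec n) + inner ℝ ζ (x' - 0) ≤ wnorm M x') (d : Vec n) :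
    inner ℝ ζ d ≤ wnorm M d := by
  simpa using hζ d

/-- Along a right-differentiable curve, `wnorm M` is right-differentiable, and its derivative is
given by a subgradient. -/
theorem exists_subgradient_hasDerivWithinAt (hM : M.PosDef) {x : ℝ → Vec n} {x' : Vec n} {t : ℝ}
    (hx : HasDerivWithinAt x x' (Ici t) t) :
    ∃ ζ : Vec n, (∀ y, wnorm M (x t) + inner ℝ ζ (y - x t) ≤ wnorm M y) ∧
      HasDerivWithinAt (fun s => wnorm M (x s)) (inner ℝ ζ x') (Ici t) t := by
  by_cases h0 : x t = 0
  -- At the kink, positive homogeneity turns right difference quotients of `wnorm` into `wnorm` of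
  -- difference quotients, with limit `wnorm M x'`. This subgradient realizes that value; it is `0`
  -- when `x' = 0`.
  · refine ⟨(wnorm M x')⁻¹ • act M x', fun y => ?_, ?_⟩
    · rw [h0, sub_zero, wnorm_zero, zero_add, inner_smul_left, real_inner_comm]
      simp only [conj_trivial]
      by_cases hx' : x' = 0
      · simp [hx', wnorm_nonneg]
      · rw [inv_mul_le_iff₀ (wnorm_pos hM hx')]
        exact inner_act_le_wnorm hM x' y
    · have e : inner ℝ ((wnorm M x')⁻¹ • act M x') x' = wnorm M x' := by
        rw [inner_smul_left, real_inner_comm, ← wnorm_sq hM, conj_trivial]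
        by_cases hx' : x' = 0
        · simp [hx']
        · have := wnorm_pos hM hx'
          field_simp
      rw [e]
      rw [hasDerivWithinAt_iff_tendsto_slope] at hx ⊢
      have h1 := (continuous_wnorm (M := M)).continuousAt.tendsto.comp hx
      refine h1.congr' ?_
      filter_upwards [self_mem_nhdsWithin] with s hs
      have hs' : 0 ≤ (s - t)⁻¹ := inv_nonneg.2 (sub_nonneg.2 hs.1)
      simp only [Function.comp_apply, slope, vsub_eq_sub, h0, sub_zero, wnorm_zero, smul_eq_mul]
      rw [wnorm_smul hs']
  · have hp := wnorm_pos hM h0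
    refine ⟨(wnorm M (x t))⁻¹ • act M (x t), fun y => ?_, ?_⟩
    · rw [inner_smul_left, real_inner_comm, inner_sub_left, ← wnorm_sq hM, conj_trivial,
        ← le_sub_iff_add_le', inv_mul_le_iff₀ hp]
      nlinarith [inner_act_le_wnorm hM (x t) y]
    · have h1 : HasDerivWithinAt (fun s => inner ℝ (x s) (act M (x s)))
          (inner ℝ (x t) (act M x') + inner ℝ x' (act M (x t))) (Ici t) t :=
        hx.inner ℝ ((actL M).hasFDerivAt.comp_hasDerivWithinAt t hx)
      have h2 := h1.sqrt (by rw [← wnorm_sq hM]; positivity)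
      refine h2.congr_deriv ?_
      rw [inner_act_comm hM.1 (x t) x', inner_smul_left, conj_trivial,
        real_inner_comm x' (act M (x t))]
      change _ / (2 * wnorm M (x t)) = _
      field_simp
      ring

end PosDef

section

/-! ### Differential equations -/

section ODE

variable {F : Type*} [NormedAddCommGroup F] [NormedSpace ℝ F] [CompleteSpace F]

/-- A compactly supported continuously differentiable vector field is complete. -/
theorem exists_global_solution {f : F → F} (hf : ContDiff ℝ 1 f) (hs : HasCompactSupport f)
    (a : ℝ) (x₀ : F) : ∃ α : ℝ → F, α a = x₀ ∧ ∀ t, HasDerivAt α (f (α t)) t := by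
  obtain ⟨L, hL⟩ := hf.lipschitzWith_of_hasCompactSupport hs one_ne_zero
  obtain ⟨C, hC⟩ := hs.exists_bound_of_continuous hf.continuous
  have hC0 : 0 ≤ C := (norm_nonneg _).trans (hC x₀)
  -- A field bounded by `C` moves a solution by at most `C N` in time `N`, so the Picard–Lindelöf
  -- radius `C N` permits every `N`.
  have key : ∀ N : ℝ, 0 < N → ∃ α : ℝ → F, α a = x₀ ∧
      ∀ t ∈ Ioo (a - N) (a + N), HasDerivAt α (f (α t)) t := by
    intro N hN
    have ha : a ∈ Icc (a - N) (a + N) := ⟨by linarith, by linarith⟩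
    have hpl : IsPicardLindelof (fun _ => f) (⟨a, ha⟩ : Icc (a - N) (a + N)) x₀
        ⟨C * N, by positivity⟩ 0 ⟨C, hC0⟩ L := by
      refine IsPicardLindelof.of_time_independent (fun x _ => hC x) hL.lipschitzOnWith ?_
      simp only [add_sub_cancel_left, sub_sub_cancel, max_self, NNReal.coe_zero, sub_zero]
      exact le_rfl
    obtain ⟨α, h1, h2⟩ := hpl.exists_eq_forall_mem_Icc_hasDerivWithinAt₀
    exact ⟨α, h1, fun t ht =>
      (h2 t (Ioo_subset_Icc_self ht)).hasDerivAt (Icc_mem_nhds ht.1 ht.2)⟩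
  have key' : ∀ n : ℕ, ∃ α : ℝ → F, α a = x₀ ∧
      ∀ t ∈ Ioo (a - (n + 1)) (a + (n + 1)), HasDerivAt α (f (α t)) t :=
    fun n => key (n + 1) (by positivity)
  choose α hα0 hα using key'
  have huniq : ∀ i j : ℕ, i ≤ j → EqOn (α i) (α j) (Ioo (a - (i + 1)) (a + (i + 1))) := by
    intro i j hij
    have hij' : (i : ℝ) ≤ j := by exact_mod_cast hij
    have hi0 : (0 : ℝ) ≤ i := by positivity
    refine ODE_solution_unique_of_mem_Ioo (v := fun _ => f) (s := fun _ => univ) (K := L)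
      (t₀ := a) (fun t _ => hL.lipschitzOnWith) ⟨by linarith, by linarith⟩
      (fun t ht => ⟨hα i t ht, trivial⟩)
      (fun t ht => ⟨hα j t ⟨by linarith [ht.1], by linarith [ht.2]⟩, trivial⟩)
      ((hα0 i).trans (hα0 j).symm)
  have heq : ∀ (i : ℕ) (t : ℝ), t ∈ Ioo (a - (i + 1)) (a + (i + 1)) →
      α ⌈|t - a|⌉₊ t = α i t := by
    intro i t ht
    have h1 : |t - a| < ⌈|t - a|⌉₊ + 1 := (Nat.le_ceil _).trans_lt (lt_add_one _)
    rw [abs_lt] at h1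
    rcases le_total ⌈|t - a|⌉₊ i with h | h
    · exact huniq _ _ h ⟨by linarith [h1.1], by linarith [h1.2]⟩
    · exact (huniq _ _ h ht).symm
  refine ⟨fun t => α ⌈|t - a|⌉₊ t, hα0 _, fun t => ?_⟩
  set i := ⌈|t - a|⌉₊ with hi
  have h1 : |t - a| < i + 1 := (Nat.le_ceil _).trans_lt (lt_add_one _)
  rw [abs_lt] at h1
  have ht : t ∈ Ioo (a - (i + 1)) (a + (i + 1)) := ⟨by linarith [h1.1], by linarith [h1.2]⟩
  refine (hα i t ht).congr_of_eventuallyEq ?_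
  filter_upwards [Ioo_mem_nhds ht.1 ht.2] with s hs
  exact heq i s hs

end ODE

theorem hasDerivWithinAt_fst {F G : Type*} [NormedAddCommGroup F] [NormedSpace ℝ F]
    [NormedAddCommGroup G] [NormedSpace ℝ G] {f : ℝ → F × G} {f' : F × G} {s : Set ℝ} {t : ℝ}
    (hf : HasDerivWithinAt f f' s t) : HasDerivWithinAt (fun t => (f t).1) f'.1 s t :=
  (ContinuousLinearMap.fst ℝ F G).hasFDerivAt.comp_hasDerivWithinAt t hf

theorem hasDerivWithinAt_snd {F G : Type*} [NormedAddCommGroup F] [NormedSpace ℝ F]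
    [NormedAddCommGroup G] [NormedSpace ℝ G] {f : ℝ → F × G} {f' : F × G} {s : Set ℝ} {t : ℝ}
    (hf : HasDerivWithinAt f f' s t) : HasDerivWithinAt (fun t => (f t).2) f'.2 s t :=
  (ContinuousLinearMap.snd ℝ F G).hasFDerivAt.comp_hasDerivWithinAt t hf

/-! ### The closed loop near the origin -/

variable {k q m : ℕ} (S : Plant k q m) (K : Feedback k q m) (E : Matrix (Fin q) (Fin k) ℝ)

/-- The arguments `(y, z, u)` of the plant nonlinearities as a function of the state `(y, v)` and
the measurement error. -/
noncomputable def loopArg (X : Vec k × Vec q × Vec k × Vec q) : Vec k × Vec q × Vec m :=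
  (X.1, X.2.1 + act E X.1,
    K.law (X.1 + X.2.2.1) (X.2.1 + X.2.2.2 + act E (X.1 + X.2.2.1)))

theorem contDiff_act {a b : ℕ} (M : Matrix (Fin a) (Fin b) ℝ) {n : WithTop ℕ∞} :
    ContDiff ℝ n (act M) := (actL M).contDiff

theorem contDiff_law : ContDiff ℝ 1 (fun x : Vec k × Vec q => K.law x.1 x.2) := by
  unfold Feedback.law
  exact (((contDiff_act _).comp contDiff_snd).add ((contDiff_act _).comp contDiff_fst)).add
    (K.Kn_contDiff.comp contDiff_fst)

theorem contDiff_loopArg : ContDiff ℝ 1 (loopArg K E) := by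
  unfold loopArg Feedback.law
  simp only [act_eq_actL]
  have := K.Kn_contDiff
  fun_prop

@[simp]
theorem law_zero : K.law 0 0 = 0 := by simp [Feedback.law, K.Kn_zero]

theorem loopArg_zero : loopArg K E 0 = 0 := by
  simp [loopArg]

theorem contDiff_yField :
    ContDiff ℝ 1 (fun x : Vec k × Vec q × Vec m => S.yField x.1 x.2.1 x.2.2) := by
  unfold Plant.yField
  exact ((contDiff_act _).comp contDiff_fst).add (S.g₁_contDiff.of_le (by norm_num))

theorem contDiff_zField :
    ContDiff ℝ 1 (fun x : Vec k × Vec q × Vec m => S.zField x.1 x.2.1 x.2.2) := by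
  unfold Plant.zField
  exact (((contDiff_act _).comp (contDiff_fst.comp contDiff_snd)).add
    ((contDiff_act _).comp (contDiff_snd.comp contDiff_snd))).add
      (S.g₂_contDiff.of_le (by norm_num))

theorem contDiff_yRate :
    ContDiff ℝ 1 (fun X : Vec k × Vec q × Vec k × Vec q =>
      yRate S K E X.1 X.2.1 X.2.2.1 X.2.2.2) := by
  have h1 := (contDiff_yField S).comp (contDiff_loopArg K E)
  exact h1

theorem contDiff_vRate :
    ContDiff ℝ 1 (fun X : Vec k × Vec q × Vec k × Vec q =>
      vRate S K E X.1 X.2.1 X.2.2.1 X.2.2.2) := by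
  have h1 := (contDiff_zField S).comp (contDiff_loopArg K E)
  have h2 := (contDiff_act E).comp (contDiff_yRate S K E)
  exact h1.sub h2

/-- Strictness matters: it compares the values at two points near `x`, with an error small relative
to their difference rather than to their distances from `x`. -/
theorem hasStrictFDerivAt_zero_comp {F G H : Type*} [NormedAddCommGroup F] [NormedSpace ℝ F]
    [NormedAddCommGroup G] [NormedSpace ℝ G] [NormedAddCommGroup H] [NormedSpace ℝ H]
    {g : G → H} {f : F → G} {x : F} (hg : ContDiff ℝ 1 g) (hg0 : fderiv ℝ g (f x) = 0)
    (hf : ContDiff ℝ 1 f) : HasStrictFDerivAt (fun x => g (f x)) (0 : F →L[ℝ] H) x := by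
  have h1 := hg.contDiffAt.hasStrictFDerivAt (x := f x) one_ne_zero
  have h2 := h1.comp x (hf.contDiffAt.hasStrictFDerivAt one_ne_zero)
  rw [hg0, ContinuousLinearMap.zero_comp] at h2
  exact h2

theorem hasStrictFDerivAt_yRate (hA₁ : S.A₁ = 0) :
    HasStrictFDerivAt (fun X : Vec k × Vec q × Vec k × Vec q =>
      yRate S K E X.1 X.2.1 X.2.2.1 X.2.2.2) (0 : _ →L[ℝ] Vec k) 0 := by
  have := hasStrictFDerivAt_zero_comp (x := 0) (S.g₁_contDiff.of_le (by norm_num))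
    (by rw [loopArg_zero]; exact S.g₁_deriv) (contDiff_loopArg K E)
  refine this.congr_of_eventuallyEq (Eventually.of_forall fun X => ?_)
  simp [yRate, Plant.yField, hA₁, loopArg]

/-- The part of `vRate` which is of higher order at the origin. -/
noncomputable def vRem (X : Vec k × Vec q × Vec k × Vec q) : Vec q :=
  act S.B₂ (K.Kn (X.1 + X.2.2.1)) + S.g₂ (loopArg K E X)
    - act E (yRate S K E X.1 X.2.1 X.2.2.1 X.2.2.2)

/-- The only possible linear contributions are `B₂ DKₙ(0)`, which vanishes by hypothesis, and `E
A₁`, which vanishes with `A₁`. -/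
theorem hasStrictFDerivAt_vRem (hA₁ : S.A₁ = 0)
    (hKn : ∀ η : Vec k, act S.B₂ (fderiv ℝ K.Kn 0 η) = 0) :
    HasStrictFDerivAt (vRem S K E) (0 : _ →L[ℝ] Vec q) 0 := by
  have h1 : HasStrictFDerivAt (fun X : Vec k × Vec q × Vec k × Vec q =>
      act S.B₂ (K.Kn (X.1 + X.2.2.1))) (0 : _ →L[ℝ] Vec q) 0 := by
    refine hasStrictFDerivAt_zero_comp (g := fun y => act S.B₂ (K.Kn y))
      (f := fun X : Vec k × Vec q × Vec k × Vec q => X.1 + X.2.2.1)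
      ((contDiff_act _).comp K.Kn_contDiff) ?_ (by fun_prop)
    simp only [Prod.fst_zero, Prod.snd_zero, add_zero]
    have h2 := (actL S.B₂).hasFDerivAt.comp (0 : Vec k)
      ((K.Kn_contDiff.differentiable one_ne_zero) 0).hasFDerivAt
    refine (h2.fderiv (f := fun y => act S.B₂ (K.Kn y))).trans ?_
    ext1 η
    exact hKn η
  have h2 := hasStrictFDerivAt_zero_comp (x := 0) (S.g₂_contDiff.of_le (by norm_num))
    (by rw [loopArg_zero]; exact S.g₂_deriv) (contDiff_loopArg K E)
  have h3 := (actL E).hasStrictFDerivAt.comp _ (hasStrictFDerivAt_yRate S K E hA₁)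
  rw [ContinuousLinearMap.comp_zero] at h3
  have := (h1.add h2).sub h3
  rw [add_zero, sub_zero] at this
  exact this

/-- The linear terms in `y` add up to `(A_K E + B₂ K₁₂) y`, which is zero by the equation for `E`
with `A₁ = 0`. -/
theorem vRate_eq (hA₁ : S.A₁ = 0) (hE : AK S K * E - E * S.A₁ + S.B₂ * K.K₁₂ = 0)
    (y : Vec k) (v : Vec q) (ey : Vec k) (ev : Vec q) :
    vRate S K E y v ey ev = act (AK S K) v
      + (act (S.B₂ * (K.K₁₂ + K.K₁₁ * E)) ey + act (S.B₂ * K.K₁₁) ev)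
      + vRem S K E (y, v, ey, ev) := by
  have h1 : act (AK S K * E + S.B₂ * K.K₁₂) y = 0 := by
    rw [hA₁, Matrix.mul_zero, sub_zero] at hE
    rw [hE, zero_act]
  simp only [AK, Matrix.add_mul, add_act, mul_act] at h1
  simp only [vRate, vRem, Plant.zField, Feedback.law, loopArg, AK, add_act, mul_act, act_add]
  rw [← sub_eq_zero, ← h1]
  abel

/-- The invariance equation of a center manifold. -/
theorem IsCenterManifold.invariance_eq {h : Vec k → Vec q} {ρ : ℝ}
    (hh : IsCenterManifold S K E h ρ) {y₀ : Vec k} (hy₀ : ‖y₀‖ < ρ) :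
    vRate S K E y₀ (h y₀) 0 0 = fderiv ℝ h y₀ (yRate S K E y₀ (h y₀) 0 0) := by
  have hi : ContDiff ℝ 1 (fun x : Vec k × Vec q => (x.1, x.2, (0 : Vec k), (0 : Vec q))) := by
    fun_prop
  have hf : ContDiff ℝ 1 (fun x : Vec k × Vec q =>
      (yRate S K E x.1 x.2 0 0, vRate S K E x.1 x.2 0 0)) := by
    have h1 := (contDiff_yRate S K E).comp hi
    have h2 := (contDiff_vRate S K E).comp hi
    exact h1.prodMk h2
  generalize hG : (fun x : Vec k × Vec q =>
      (yRate S K E x.1 x.2 0 0, vRate S K E x.1 x.2 0 0)) = G at hf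
  -- The solution through the point `(y₀, h y₀)` of the graph satisfies `v = h(y)` for a short time;
  -- the claim is the derivative of this identity at time `0` from the right.
  obtain ⟨α, hα0, ε, hε, hα⟩ :=
    hf.contDiffAt.exists_forall_mem_closedBall_exists_eq_forall_mem_Ioo_hasDerivAt₀
      (x₀ := (y₀, h y₀)) 0
  have hα' := hα 0 ⟨by linarith, by linarith⟩
  have hcont : ContinuousAt (fun t => (α t).1) 0 := hα'.continuousAt.fst
  have hnear : ∀ᶠ t in 𝓝 (0 : ℝ), (α t).1 ∈ Metric.ball (0 : Vec k) ρ :=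
    hcont.eventually_mem (Metric.isOpen_ball.mem_nhds (by simpa [hα0] using hy₀))
  obtain ⟨ε', hε', hb⟩ := Metric.eventually_nhds_iff.1 hnear
  set T := min ε ε' with hT
  have hT0 : 0 < T := lt_min hε hε'
  have hd : ∀ t ∈ Ico 0 T, HasDerivAt α
      (yRate S K E (α t).1 (α t).2 0 0, vRate S K E (α t).1 (α t).2 0 0) t := by
    intro t ht
    have := hα t ⟨by linarith [ht.1], by linarith [ht.2.trans_le (min_le_left ε ε')]⟩
    rwa [← hG] at this
  have hinv := hh.invariant T (fun t => (α t).1) (fun t => (α t).2) hT0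
    (fun t ht => hb (by
      rw [Real.dist_eq, sub_zero, abs_of_nonneg ht.1]
      exact ht.2.trans_le (min_le_right ε ε')))
    (fun t ht => hasDerivWithinAt_fst (hd t ht).hasDerivWithinAt)
    (fun t ht => hasDerivWithinAt_snd (hd t ht).hasDerivWithinAt)
    (by simp [hα0])
  have h00 : (0 : ℝ) ∈ Ico 0 T := ⟨le_rfl, hT0⟩
  have hdiff : HasFDerivAt h (fderiv ℝ h y₀) y₀ :=
    ((hh.contDiffOn.differentiableOn one_ne_zero).differentiableAt
      (Metric.isOpen_ball.mem_nhds (by simpa using hy₀))).hasFDerivAt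
  have e1 : HasDerivWithinAt (fun t => (α t).2) (vRate S K E y₀ (h y₀) 0 0) (Ico 0 T) 0 := by
    have := hasDerivWithinAt_snd ((hd 0 h00).hasDerivWithinAt (s := Ico 0 T))
    rwa [hα0] at this
  have e2 : HasDerivWithinAt (fun t => h (α t).1)
      (fderiv ℝ h y₀ (yRate S K E y₀ (h y₀) 0 0)) (Ico 0 T) 0 := by
    have := hasDerivWithinAt_fst ((hd 0 h00).hasDerivWithinAt (s := Ico 0 T))
    rw [hα0] at this
    exact HasFDerivAt.comp_hasDerivWithinAt (f := fun t => (α t).1) 0 (by rw [hα0]; exact hdiff)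
      this
  have e3 := e2.congr hinv (hinv 0 h00)
  exact (uniqueDiffOn_Ico (0 : ℝ) T 0 h00).eq_deriv _ e1 e3

theorem yRate_eq_reducedG₁ (hA₁ : S.A₁ = 0) (h : Vec k → Vec q) (y : Vec k) :
    yRate S K E y (h y) 0 0 = reducedG₁ S K E h y := by
  simp [yRate, reducedG₁, Plant.yField, hA₁]

theorem norm_le_pairNorm_left {a b : ℕ} (x : Vec a) (y : Vec b) : ‖x‖ ≤ pairNorm x y :=
  Real.le_sqrt_of_sq_le (by nlinarith [sq_nonneg ‖y‖])

theorem norm_le_pairNorm_right {a b : ℕ} (x : Vec a) (y : Vec b) : ‖y‖ ≤ pairNorm x y :=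
  Real.le_sqrt_of_sq_le (by nlinarith [sq_nonneg ‖x‖])

theorem pairNorm_nonneg {a b : ℕ} (x : Vec a) (y : Vec b) : 0 ≤ pairNorm x y := Real.sqrt_nonneg _

theorem pairNorm_le_add {a b : ℕ} (x : Vec a) (y : Vec b) : pairNorm x y ≤ ‖x‖ + ‖y‖ :=
  Real.sqrt_le_iff.2 ⟨by positivity, by nlinarith [norm_nonneg x, norm_nonneg y]⟩

@[simp]
theorem pairNorm_zero {a b : ℕ} : pairNorm (0 : Vec a) (0 : Vec b) = 0 := by simp [pairNorm]

theorem continuous_pairNorm {a b : ℕ} : Continuous fun x : Vec a × Vec b => pairNorm x.1 x.2 := by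
  unfold pairNorm
  fun_prop

theorem IsCenterManifold.continuousOn {h : Vec k → Vec q} {ρ : ℝ}
    (hh : IsCenterManifold S K E h ρ) : ContinuousOn h (Metric.ball 0 ρ) :=
  hh.contDiffOn.continuousOn

theorem IsCenterManifold.hasFDerivAt {h : Vec k → Vec q} {ρ : ℝ}
    (hh : IsCenterManifold S K E h ρ) {y : Vec k} (hy : ‖y‖ < ρ) :
    HasFDerivAt h (fderiv ℝ h y) y :=
  ((hh.contDiffOn.differentiableOn one_ne_zero).differentiableAt
      (Metric.isOpen_ball.mem_nhds (by simpa using hy))).hasFDerivAt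

/-- Near the origin the closed loop is the reduced system in `y` and a linear system in `w` and
the measurement error, up to terms that are small relative to `w` and the error. -/
theorem exists_rate_bounds (hA₁ : S.A₁ = 0)
    (hKn : ∀ η : Vec k, act S.B₂ (fderiv ℝ K.Kn 0 η) = 0)
    (hE : AK S K * E - E * S.A₁ + S.B₂ * K.K₁₂ = 0) {h : Vec k → Vec q} {ρ : ℝ}
    (hh : IsCenterManifold S K E h ρ) {ε : ℝ} (hε : 0 < ε) :
    ∃ δ > 0, ∀ (y : Vec k) (w : Vec q) (ey : Vec k) (ev : Vec q), ‖y‖ < δ → ‖w‖ < δ →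
      pairNorm ey ev < δ →
      ‖yRate S K E y (w + h y) ey ev - reducedG₁ S K E h y‖ ≤ ε * (‖w‖ + pairNorm ey ev) ∧
      ‖wRate S K E h y w ey ev - (act (AK S K) w
        + (act (S.B₂ * (K.K₁₂ + K.K₁₁ * E)) ey + act (S.B₂ * K.K₁₁) ev))‖
        ≤ ε * (‖w‖ + pairNorm ey ev) := by
  -- One half of `ε` goes to the remainder in `v'`, the other to `Dh(y)` times the error in `y'`,
  -- where `‖Dh(y)‖ < 1`.
  have hy := (hasStrictFDerivAt_yRate S K E hA₁).isLittleO.def (c := ε / 2) (by positivity)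
  have hv := (hasStrictFDerivAt_vRem S K E hA₁ hKn).isLittleO.def (c := ε / 2) (by positivity)
  obtain ⟨U, hU, hUp⟩ := Metric.eventually_nhds_iff.1 (hy.and hv)
  have hball : Metric.ball (0 : Vec k) ρ ∈ 𝓝 0 := Metric.ball_mem_nhds 0 hh.radius_pos
  have hhc : ContinuousAt h 0 := hh.contDiffOn.continuousOn.continuousAt hball
  have hdc : ContinuousAt (fderiv ℝ h) 0 :=
    (hh.contDiffOn.continuousOn_fderiv_of_isOpen Metric.isOpen_ball le_rfl).continuousAt hball
  have hsm : ∀ᶠ y in 𝓝 (0 : Vec k), ‖h y‖ < U / 2 ∧ ‖fderiv ℝ h y‖ < 1 ∧ ‖y‖ < ρ := by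
    refine ((hhc.norm).eventually_lt_const (by simpa [hh.zero] using hU)).and
      (((hdc.norm).eventually_lt_const (by simp [hh.deriv_zero])).and ?_)
    filter_upwards [hball] with y hy using by simpa using hy
  obtain ⟨r, hr, hrp⟩ := Metric.eventually_nhds_iff.1 hsm
  refine ⟨min r (U / 2), lt_min hr (by positivity), fun y w ey ev h1 h2 h3 => ?_⟩
  obtain ⟨hy1, hy2, hy3⟩ := hrp (y := y) (by simpa using h1.trans_le (min_le_left _ _))
  have hU2 : U / 2 < U := by linarith
  have b1 : ‖y‖ < U := (h1.trans_le (min_le_right _ _)).trans hU2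
  have b2 : ‖w‖ < U / 2 := h2.trans_le (min_le_right _ _)
  have b3 : pairNorm ey ev < U := (h3.trans_le (min_le_right _ _)).trans hU2
  have b4 : ‖w + h y‖ < U := (norm_add_le _ _).trans_lt (by linarith)
  have b5 := (norm_le_pairNorm_left ey ev).trans_lt b3
  have b6 := (norm_le_pairNorm_right ey ev).trans_lt b3
  -- The two points differ only in `w` and the measurement error, so no term in `y` appears.
  obtain ⟨e1, e2⟩ := hUp (y := ((y, w + h y, ey, ev), (y, h y, 0, 0))) (by
    simp [dist_eq_norm, Prod.norm_def, b1, b4, b5, b6, hy1.trans hU2])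
  have hd : ‖((y, w + h y, ey, ev) : Vec k × Vec q × Vec k × Vec q) - (y, h y, 0, 0)‖
      ≤ ‖w‖ + pairNorm ey ev := by
    have := norm_le_pairNorm_left ey ev
    have := norm_le_pairNorm_right ey ev
    have := norm_nonneg w
    have := pairNorm_nonneg ey ev
    simp only [Prod.mk_sub_mk, sub_self, add_sub_cancel_right, sub_zero, Prod.norm_def, norm_zero]
    refine max_le (by positivity) (max_le (by linarith) (max_le (by linarith) (by linarith)))
  simp only [zero_apply, sub_zero] at e1 e2
  rw [yRate_eq_reducedG₁ S K E hA₁] at e1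
  have e1' : ‖yRate S K E y (w + h y) ey ev - reducedG₁ S K E h y‖
      ≤ ε / 2 * (‖w‖ + pairNorm ey ev) := e1.trans (by gcongr)
  have e2' := e2.trans (mul_le_mul_of_nonneg_left hd (by positivity))
  have hs : 0 ≤ ε / 2 * (‖w‖ + pairNorm ey ev) := (norm_nonneg _).trans e1'
  refine ⟨e1'.trans (by linarith), ?_⟩
  have hinv := hh.invariance_eq S K E hy3
  rw [yRate_eq_reducedG₁ S K E hA₁, vRate_eq S K E hA₁ hE] at hinv
  have hw : wRate S K E h y w ey ev - (act (AK S K) w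
        + (act (S.B₂ * (K.K₁₂ + K.K₁₁ * E)) ey + act (S.B₂ * K.K₁₁) ev))
      = (vRem S K E (y, w + h y, ey, ev) - vRem S K E (y, h y, 0, 0))
        - fderiv ℝ h y (yRate S K E y (w + h y) ey ev - reducedG₁ S K E h y) := by
    rw [wRate, vRate_eq S K E hA₁ hE, map_sub, ← hinv, act_add]
    simp only [act_zero]
    abel
  rw [hw]
  refine (norm_sub_le _ _).trans ?_
  have h5 := (fderiv ℝ h y).le_opNorm (yRate S K E y (w + h y) ey ev - reducedG₁ S K E h y)
  have h6 : ‖fderiv ℝ h y‖ * ‖yRate S K E y (w + h y) ey ev - reducedG₁ S K E h y‖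
      ≤ 1 * (ε / 2 * (‖w‖ + pairNorm ey ev)) := by gcongr
  linarith

end

section

/-! ### Decrease of the Lyapunov function -/

/-- Both blocks act on the stacked error as the single matrix `P B K₁`, whose norm enters the
condition on `σ`. -/
theorem norm_act_input_le {k q m : ℕ} (K : Feedback k q m) (E : Matrix (Fin q) (Fin k) ℝ)
    (P : Matrix (Fin q) (Fin q) ℝ) (B : Matrix (Fin q) (Fin m) ℝ) (ey : Vec k) (ev : Vec q) :
    ‖act P (act (B * (K.K₁₂ + K.K₁₁ * E)) ey + act (B * K.K₁₁) ev)‖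
      ≤ opNorm (P * B * K1 K E) * pairNorm ey ev := by
  set e : EuclideanSpace ℝ (Fin k ⊕ Fin q) := WithLp.toLp 2 (Sum.elim ey ev) with he
  have hn : ‖e‖ = pairNorm ey ev := by
    rw [EuclideanSpace.norm_eq, pairNorm, EuclideanSpace.norm_sq_eq, EuclideanSpace.norm_sq_eq]
    simp [he, Fintype.sum_sum_type]
  have ha : act P (act (B * (K.K₁₂ + K.K₁₁ * E)) ey + act (B * K.K₁₁) ev)
      = LinearMap.toContinuousLinearMap (Matrix.toEuclideanLin (P * B * K1 K E)) e := by
    rw [act_add, ← mul_act, ← mul_act]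
    ext i
    simp only [act, K1, he, LinearMap.coe_toContinuousLinearMap', Matrix.toLpLin_apply,
      PiLp.add_apply, ← Matrix.mul_assoc, Matrix.mul_fromCols, Matrix.fromCols_mulVec]
    simp
  rw [ha, ← hn]
  exact ContinuousLinearMap.le_opNorm _ _

/-! ### Subgradients of `V`, one variable at a time -/

section Subdifferential

variable {k q : ℕ} {P : Matrix (Fin q) (Fin q) ℝ} {y : Vec k} {w : Vec q} {ζ : Vec k × Vec q}

theorem lyapSubdiff_fst (hζ : ζ ∈ lyapSubdiff P y w) (y' : Vec k) :
    ‖y‖ + inner ℝ ζ.1 (y' - y) ≤ ‖y'‖ := by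
  have := hζ y' w
  simp only [lyap, sub_self, inner_zero_right, add_zero] at this
  linarith

theorem lyapSubdiff_snd (hζ : ζ ∈ lyapSubdiff P y w) (w' : Vec q) :
    wnorm P w + inner ℝ ζ.2 (w' - w) ≤ wnorm P w' := by
  have := hζ y w'
  simp only [lyap, sub_self, inner_zero_right, add_zero] at this
  simp only [wnorm]
  linarith

theorem inner_le_norm_of_lyapSubdiff (hζ : ζ ∈ lyapSubdiff P y w) (d : Vec k) :
    inner ℝ ζ.1 d ≤ ‖d‖ := by
  have := lyapSubdiff_fst hζ (y + d)
  rw [add_sub_cancel_left] at this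
  linarith [norm_add_le y d]

theorem inner_le_div_of_lyapSubdiff (hζ : ζ ∈ lyapSubdiff P y w) (hy : y ≠ 0) (d : Vec k) :
    inner ℝ ζ.1 d ≤ inner ℝ y d / ‖y‖ := by
  have := inner_le_of_subgradient (M := 1) Matrix.PosDef.one (x := y) (ζ := ζ.1)
    (fun x' => by simpa only [wnorm_one] using lyapSubdiff_fst hζ x') hy d
  rwa [wnorm_one, one_act, real_inner_comm y d] at this

end Subdifferential

theorem inner_lyapunov_eq {q : ℕ} {P Q A : Matrix (Fin q) (Fin q) ℝ} (hP : P.IsHermitian)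
    (hLyap : A.transpose * P + P * A = -Q) (w : Vec q) :
    inner ℝ (act A w) (act P w) = -(inner ℝ w (act Q w) / 2) := by
  have h1 : inner ℝ w (act (A.transpose * P + P * A) w) = -inner ℝ w (act Q w) := by
    rw [hLyap, neg_act, inner_neg_right]
  rw [add_act, inner_add_right, mul_act, mul_act, inner_act, Matrix.transpose_transpose,
    inner_act_comm hP w] at h1
  linarith

/-- The derivative of `√(wᵀ P w)` along `w' = A w + b + r`. -/
theorem inner_le_of_lyapunov {k q : ℕ} (hq : 0 < q) {P Q A : Matrix (Fin q) (Fin q) ℝ}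
    (hP : P.PosDef) (hQ : Q.PosDef) (hLyap : A.transpose * P + P * A = -Q)
    {y : Vec k} {w : Vec q} {ζ : Vec k × Vec q} (hζ : ζ ∈ lyapSubdiff P y w) {b r : Vec q}
    {β γ : ℝ} (hb : ‖b‖ ≤ γ) (hPb : ‖act P b‖ ≤ β) :
    inner ℝ ζ.2 (act A w + b + r) ≤ -(lambdaMin Q / (2 * √(lambdaMax P)) * ‖w‖)
      + (if w = 0 then √(lambdaMax P) * γ else β / √(lambdaMin P)) + √(lambdaMax P) * ‖r‖ := by
  have hM := Real.sqrt_pos.2 (lambdaMax_pos hq hP)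
  have hm := Real.sqrt_pos.2 (lambdaMin_pos hq hP)
  have hlQ := lambdaMin_pos hq hQ
  -- At `w = 0` only `⟪ζ, d⟫ ≤ wnorm P d` is available, which costs a multiple of `‖b‖`. For `w ≠ 0`
  -- testing with `P w / wnorm P w` leads to `‖P b‖ / √λ_min(P)`, the quantity that the condition on
  -- `σ` controls.
  by_cases hw : w = 0
  · subst hw
    have h1 := inner_le_of_subgradient_zero (M := P) (lyapSubdiff_snd hζ)
      (act A 0 + b + r)
    have h2 := wnorm_le hq hP (act A 0 + b + r)
    rw [if_pos rfl]
    simp only [act_zero, zero_add, norm_zero, mul_zero, neg_zero] at h1 h2 ⊢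
    have h3 : ‖b + r‖ ≤ γ + ‖r‖ := (norm_add_le _ _).trans (by linarith)
    have h4 := mul_le_mul_of_nonneg_left h3 hM.le
    linarith
  · have hN := wnorm_pos hP hw
    have hwn : 0 < ‖w‖ := norm_pos_iff.2 hw
    have h1 := inner_le_of_subgradient hP (lyapSubdiff_snd hζ) hw (act A w + b + r)
    rw [if_neg hw]
    refine h1.trans ?_
    rw [inner_add_left, inner_add_left, inner_lyapunov_eq hP.1 hLyap, add_div, add_div]
    refine add_le_add (add_le_add ?_ ?_) ?_
    · rw [neg_div, neg_le_neg_iff, le_div_iff₀ hN]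
      have h2 := wnorm_le hq hP w
      have h3 := lambdaMin_mul_le hQ.1 w
      calc lambdaMin Q / (2 * √(lambdaMax P)) * ‖w‖ * wnorm P w
          ≤ lambdaMin Q / (2 * √(lambdaMax P)) * ‖w‖ * (√(lambdaMax P) * ‖w‖) := by gcongr
        _ = lambdaMin Q * ‖w‖ ^ 2 / 2 := by field_simp
        _ ≤ _ := by linarith
    · have h2 : inner ℝ b (act P w) ≤ ‖w‖ * β := by
        rw [inner_act_comm hP.1]
        exact (real_inner_le_norm _ _).trans (by gcongr)
      have h3 := le_wnorm hq hP w
      have hβ : 0 ≤ β := (norm_nonneg _).trans hPb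
      rw [div_le_div_iff₀ hN hm]
      calc inner ℝ b (act P w) * √(lambdaMin P) ≤ ‖w‖ * β * √(lambdaMin P) := by gcongr
        _ = β * (√(lambdaMin P) * ‖w‖) := by ring
        _ ≤ β * wnorm P w := by gcongr
    · rw [div_le_iff₀ hN]
      refine (inner_act_le_wnorm hP w r).trans ?_
      rw [mul_comm]
      exact mul_le_mul_of_nonneg_right (wnorm_le hq hP r) hN.le

theorem DecreasesOn.mono {k q m : ℕ} {S : Plant k q m} {K : Feedback k q m}
    {E : Matrix (Fin q) (Fin k) ℝ} {h ha : Vec k → Vec q} {P : Matrix (Fin q) (Fin q) ℝ}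
    {σ p cy cw δ δ' : ℝ} (hd : DecreasesOn S K E h ha P σ p cy cw δ') (hδ : δ ≤ δ') :
    DecreasesOn S K E h ha P σ p cy cw δ :=
  fun y w ey ev h1 => hd y w ey ev (h1.trans_le hδ)

/-- Both `s` and `p + 1` exceed `p`: after dividing by `‖y‖ ^ p` the factor `C ‖y‖ ^ (s - p) + ‖y‖`
tends to zero. -/
theorem eventually_approx_error_le {k q : ℕ} {h ha : Vec k → Vec q} {p s : ℝ} (hp : 0 < p)
    (hs : p < s) (hH : (fun y => h y - ha y) =O[𝓝 0] fun y => ‖y‖ ^ s) {η : ℝ} (hη : 0 < η) :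
    ∀ᶠ y in 𝓝 (0 : Vec k), ‖h y - ha y‖ + ‖y‖ ^ (p + 1) ≤ η * ‖y‖ ^ p := by
  obtain ⟨C, hC⟩ := hH.bound
  have hc : ContinuousAt (fun y : Vec k => C * ‖y‖ ^ (s - p) + ‖y‖) 0 := by
    refine (continuousAt_const.mul
      (continuous_norm.continuousAt.rpow_const (Or.inr ?_))).add continuous_norm.continuousAt
    linarith
  have h0 : C * ‖(0 : Vec k)‖ ^ (s - p) + ‖(0 : Vec k)‖ < η := by
    rw [norm_zero, Real.zero_rpow (by linarith)]
    simpa using hη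
  filter_upwards [hC, hc.eventually_lt_const h0] with y h1 h2
  have hy := norm_nonneg y
  rw [Real.norm_of_nonneg (by positivity)] at h1
  have e1 : ‖y‖ ^ s = ‖y‖ ^ p * ‖y‖ ^ (s - p) := by
    rw [← Real.rpow_add' hy (by linarith)]; congr 1; ring
  have e2 : ‖y‖ ^ (p + 1) = ‖y‖ ^ p * ‖y‖ := by
    rw [Real.rpow_add' hy (by linarith), Real.rpow_one]
  have hpp : 0 ≤ ‖y‖ ^ p := by positivity
  rw [e1] at h1
  rw [e2]
  nlinarith

/-- Passing from `wᵃ` to the true `w` leaves the coefficient `σ` intact, so the approximation of `h`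
costs nothing in the gain condition. -/
theorem trigger_error_le {k q : ℕ} {h ha : Vec k → Vec q} {y : Vec k} {w : Vec q}
    {σ p η e : ℝ} (hσ : 0 < σ)
    (happ : ‖h y - ha y‖ + ‖y‖ ^ (p + 1) ≤ η / σ * ‖y‖ ^ p)
    (he : e ≤ σ * (‖w + h y - ha y‖ + ‖y‖ ^ (p + 1))) : e ≤ σ * ‖w‖ + η * ‖y‖ ^ p := by
  have h1 : ‖w + h y - ha y‖ ≤ ‖w‖ + ‖h y - ha y‖ := by
    rw [add_sub_assoc]; exact norm_add_le _ _
  calc e ≤ σ * (‖w + h y - ha y‖ + ‖y‖ ^ (p + 1)) := he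
    _ ≤ σ * (‖w‖ + η / σ * ‖y‖ ^ p) := mul_le_mul_of_nonneg_left (by linarith) hσ.le
    _ = σ * ‖w‖ + η * ‖y‖ ^ p := by field_simp

theorem exists_decreasesOn {k q m : ℕ} (hq : 0 < q)
    (S : Plant k q m) (K : Feedback k q m)
    (hKn : ∀ η : Vec k, act S.B₂ (fderiv ℝ K.Kn 0 η) = 0)
    (E : Matrix (Fin q) (Fin k) ℝ)
    (hE : AK S K * E - E * S.A₁ + S.B₂ * K.K₁₂ = 0)
    {h ha : Vec k → Vec q} {ρ : ℝ} (hh : IsCenterManifold S K E h ρ) (hA₁ : S.A₁ = 0)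
    {p k₅ k₆ : ℝ} (hp : 0 < p) (hk₆ : 0 < k₆)
    (hg_le : ∀ᶠ y in 𝓝 (0 : Vec k), ‖reducedG₁ S K E h y‖ ≤ k₅ * ‖y‖ ^ p)
    (hg_inner : ∀ᶠ y in 𝓝 (0 : Vec k),
      inner ℝ y (reducedG₁ S K E h y) ≤ -k₆ * ‖y‖ ^ (p + 1))
    {s : ℝ} (hs : p < s) (hH : (fun y => h y - ha y) =O[𝓝 0] fun y => ‖y‖ ^ s)
    {P Q : Matrix (Fin q) (Fin q) ℝ} (hP : P.PosDef) (hQ : Q.PosDef)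
    (hLyap : (AK S K).transpose * P + P * AK S K = -Q)
    {sf : ℝ} (hsf : 0 < sf) {σ : ℝ} (hσ : 0 < σ)
    (hσ_le : σ * (2 * opNorm (P * S.B₂ * K1 K E) * √(lambdaMax P))
      ≤ (1 - sf) * lambdaMin Q * √(lambdaMin P)) :
    ∃ δ > 0, ∃ cy > 0, ∃ cw > 0, DecreasesOn S K E h ha P σ p cy cw δ := by
  have hM := Real.sqrt_pos.2 (lambdaMax_pos hq hP)
  have hm := Real.sqrt_pos.2 (lambdaMin_pos hq hP)
  have hlQ := lambdaMin_pos hq hQ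
  have hκ : 0 ≤ opNorm (P * S.B₂ * K1 K E) := norm_nonneg _
  set κ := opNorm (P * S.B₂ * K1 K E) with hκ_def
  set M := √(lambdaMax P)
  set μ := √(lambdaMin P)
  set lQ := lambdaMin Q
  -- The reserved fraction `s_f` of the linear decay; the rest is used up by the `σ ‖w‖` part of the
  -- error.
  set θ := sf * lQ / (2 * M) with hθ_def
  have hθ : 0 < θ := by positivity
  have hgain : κ * σ / μ ≤ lQ / (2 * M) - θ := by
    have : lQ / (2 * M) - θ = (1 - sf) * lQ / (2 * M) := by rw [hθ_def]; ring
    rw [this, div_le_div_iff₀ hm (by positivity)]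
    nlinarith
  set C₀ := ‖actL (S.B₂ * (K.K₁₂ + K.K₁₁ * E))‖ + ‖actL (S.B₂ * K.K₁₁)‖ with hC₀_def
  have hC₀ : 0 ≤ C₀ := by positivity
  set C₁ := κ / μ + M * C₀ with hC₁_def
  have hC₁ : 0 ≤ C₁ := by positivity
  -- Chosen so that the remainders of both equations consume only half of `θ ‖w‖`.
  set ε := θ / (2 * (1 + M) * (1 + σ)) with hε_def
  have hε : 0 < ε := by positivity
  have hε_eq : (1 + M) * ε * (1 + σ) = θ / 2 := by rw [hε_def]; field_simp
  set C₂ := (1 + M) * ε with hC₂_def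
  have hC₂ : 0 < C₂ := by positivity
  -- The terms in `η ‖y‖ ^ p` enter with total coefficient `C₁ + C₂`, hence consume only half of
  -- `k₆`.
  set η := k₆ / (2 * (C₁ + C₂)) with hη_def
  have hη : 0 < η := by positivity
  have hη_eq : (C₁ + C₂) * η = k₆ / 2 := by rw [hη_def]; field_simp
  obtain ⟨δ₁, hδ₁, hrate⟩ := exists_rate_bounds S K E hA₁ hKn hE hh hε
  have happ := eventually_approx_error_le hp hs hH (η := η / σ) (by positivity)
  have hsmall : ∀ᶠ y in 𝓝 (0 : Vec k), η * ‖y‖ ^ p < δ₁ / 2 := by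
    have : ContinuousAt (fun y : Vec k => η * ‖y‖ ^ p) 0 :=
      continuousAt_const.mul (continuous_norm.continuousAt.rpow_const (Or.inr hp.le))
    refine this.eventually_lt_const ?_
    beta_reduce
    rw [norm_zero, Real.zero_rpow hp.ne']
    simpa using hδ₁
  obtain ⟨r, hr, hrp⟩ := Metric.eventually_nhds_iff.1
    (hg_le.and (hg_inner.and (happ.and hsmall)))
  -- The last radius gives `σ ‖w‖ < δ₁ / 2`, which together with `hsmall` keeps the error below
  -- `δ₁`.
  refine ⟨min r (min δ₁ (δ₁ / (2 * σ))), by positivity, k₆ / 2, by positivity, θ / 2,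
    by positivity, ?_⟩
  intro y w ey ev hyw he ζ hζ
  have hyn := (norm_le_pairNorm_left y w).trans_lt hyw
  have hwn := (norm_le_pairNorm_right y w).trans_lt hyw
  obtain ⟨g1, g2, g3, g4⟩ := hrp (y := y) (by simpa using hyn.trans_le (min_le_left _ _))
  have hy1 : ‖y‖ < δ₁ := hyn.trans_le ((min_le_right _ _).trans (min_le_left _ _))
  have hw1 : ‖w‖ < δ₁ := hwn.trans_le ((min_le_right _ _).trans (min_le_left _ _))
  have hw2 : ‖w‖ < δ₁ / (2 * σ) := hwn.trans_le ((min_le_right _ _).trans (min_le_right _ _))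
  have he0 := pairNorm_nonneg ey ev
  set e := pairNorm ey ev with he_def
  have hyp : 0 ≤ ‖y‖ ^ p := by positivity
  have hϱ : e ≤ σ * ‖w‖ + η * ‖y‖ ^ p := trigger_error_le hσ g3 he
  have he1 : e < δ₁ := by
    rw [lt_div_iff₀ (by positivity)] at hw2
    linarith
  obtain ⟨r1, r2⟩ := hrate y w ey ev hy1 hw1 he1
  set b := act (S.B₂ * (K.K₁₂ + K.K₁₁ * E)) ey + act (S.B₂ * K.K₁₁) ev with hb_def
  have hb : ‖b‖ ≤ C₀ * e := by
    refine (norm_add_le _ _).trans ?_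
    rw [hC₀_def, add_mul]
    refine add_le_add (((actL _).le_opNorm ey).trans ?_) (((actL _).le_opNorm ev).trans ?_)
    · have := norm_le_pairNorm_left ey ev
      gcongr
    · have := norm_le_pairNorm_right ey ev
      gcongr
  have hPb : ‖act P b‖ ≤ κ * e := norm_act_input_le K E P S.B₂ ey ev
  have hv := inner_le_of_lyapunov hq hP hQ hLyap hζ hb hPb
    (r := wRate S K E h y w ey ev - (act (AK S K) w + b))
  rw [add_assoc, add_comm (b : Vec q), ← add_assoc, add_assoc (act (AK S K) w),
    add_comm _ b, ← add_assoc, add_sub_cancel] at hv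
  have hy : inner ℝ ζ.1 (yRate S K E y (w + h y) ey ev)
      ≤ -k₆ * ‖y‖ ^ p + ε * (‖w‖ + e) := by
    have h1 : inner ℝ ζ.1 (yRate S K E y (w + h y) ey ev)
        = inner ℝ ζ.1 (reducedG₁ S K E h y)
          + inner ℝ ζ.1 (yRate S K E y (w + h y) ey ev - reducedG₁ S K E h y) := by
      rw [← inner_add_right, add_sub_cancel]
    rw [h1]
    refine add_le_add ?_ ((inner_le_norm_of_lyapSubdiff hζ _).trans r1)
    by_cases hy0 : y = 0
    · subst hy0
      rw [norm_zero, Real.zero_rpow hp.ne', mul_zero] at g1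
      rw [norm_le_zero_iff.1 g1, norm_zero, Real.zero_rpow hp.ne']
      simp
    · have hyn0 : 0 < ‖y‖ := norm_pos_iff.2 hy0
      refine (inner_le_div_of_lyapSubdiff hζ hy0 _).trans ?_
      rw [div_le_iff₀ hyn0, mul_assoc, ← Real.rpow_add_one hyn0.ne']
      exact g2
  -- At `w = 0` the error has no `σ ‖w‖` part, so the constant `M C₀` multiplies only the small term
  -- `η ‖y‖ ^ p`.
  have hcase : (if w = 0 then M * (C₀ * e) else κ * e / μ)
      ≤ κ * σ / μ * ‖w‖ + C₁ * (η * ‖y‖ ^ p) := by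
    have hϱ0 : 0 ≤ η * ‖y‖ ^ p := by positivity
    have t1 : 0 ≤ κ / μ * (η * ‖y‖ ^ p) := by positivity
    have t2 : 0 ≤ M * C₀ * (η * ‖y‖ ^ p) := by positivity
    have t3 : C₁ * (η * ‖y‖ ^ p) = κ / μ * (η * ‖y‖ ^ p) + M * C₀ * (η * ‖y‖ ^ p) := by
      rw [hC₁_def]; ring
    rw [t3]
    split_ifs with hw0
    · rw [hw0, norm_zero, mul_zero, zero_add] at hϱ
      rw [hw0, norm_zero, mul_zero, zero_add]
      calc M * (C₀ * e) ≤ M * (C₀ * (η * ‖y‖ ^ p)) := by gcongr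
        _ ≤ _ := by linarith
    · calc κ * e / μ ≤ κ * (σ * ‖w‖ + η * ‖y‖ ^ p) / μ := by gcongr
        _ = κ * σ / μ * ‖w‖ + κ / μ * (η * ‖y‖ ^ p) := by ring
        _ ≤ _ := by linarith
  have f1 : M * ‖wRate S K E h y w ey ev - (act (AK S K) w + b)‖ ≤ M * (ε * (‖w‖ + e)) := by
    gcongr
  have f2 : κ * σ / μ * ‖w‖ ≤ (lQ / (2 * M) - θ) * ‖w‖ := by gcongr
  have f3 : C₂ * (‖w‖ + e) ≤ C₂ * ((1 + σ) * ‖w‖ + η * ‖y‖ ^ p) := by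
    refine mul_le_mul_of_nonneg_left ?_ hC₂.le
    linarith
  have f4 : C₂ * ((1 + σ) * ‖w‖ + η * ‖y‖ ^ p) = θ / 2 * ‖w‖ + C₂ * η * ‖y‖ ^ p := by
    rw [mul_add, ← mul_assoc, hε_eq]; ring
  have f5 : C₁ * (η * ‖y‖ ^ p) + C₂ * η * ‖y‖ ^ p = k₆ / 2 * ‖y‖ ^ p := by
    rw [← hη_eq]; ring
  have f6 : C₂ * (‖w‖ + e) = ε * (‖w‖ + e) + M * (ε * (‖w‖ + e)) := by rw [hC₂_def]; ring
  linarith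

end

section

/-! ### The Lyapunov function along trajectories -/

/-! ### Comparison of `V` with the Euclidean norm of `(y; w)` -/

section Geometry

variable {k q : ℕ} {P : Matrix (Fin q) (Fin q) ℝ}

theorem lyap_eq (y : Vec k) (w : Vec q) : lyap P y w = ‖y‖ + wnorm P w := rfl

theorem slope₁_pos (hq : 0 < q) (hP : P.PosDef) : 0 < slope₁ P :=
  lt_min one_pos (Real.sqrt_pos.2 (lambdaMin_pos hq hP))

theorem slope₂_pos : 0 < slope₂ P := by unfold slope₂; positivity

theorem slope₁_mul_le_lyap (hq : 0 < q) (hP : P.PosDef) (y : Vec k) (w : Vec q) :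
    slope₁ P * pairNorm y w ≤ lyap P y w := by
  have h1 := le_wnorm hq hP w
  have h2 := slope₁_pos hq hP
  calc slope₁ P * pairNorm y w ≤ slope₁ P * (‖y‖ + ‖w‖) := by
        gcongr; exact pairNorm_le_add y w
    _ = slope₁ P * ‖y‖ + slope₁ P * ‖w‖ := mul_add _ _ _
    _ ≤ 1 * ‖y‖ + √(lambdaMin P) * ‖w‖ := by
        gcongr
        · exact min_le_left _ _
        · exact min_le_right _ _
    _ ≤ lyap P y w := by rw [lyap_eq, one_mul]; gcongr

theorem lyap_le_slope₂_mul (hq : 0 < q) (hP : P.PosDef) (y : Vec k) (w : Vec q) :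
    lyap P y w ≤ slope₂ P * pairNorm y w := by
  have h1 := wnorm_le hq hP w
  have h3 : ‖y‖ + ‖w‖ ≤ √2 * pairNorm y w := by
    rw [pairNorm, ← Real.sqrt_mul (by norm_num)]
    apply Real.le_sqrt_of_sq_le
    nlinarith [sq_nonneg (‖y‖ - ‖w‖)]
  calc lyap P y w = 1 * ‖y‖ + wnorm P w := by rw [lyap_eq, one_mul]
    _ ≤ 1 * ‖y‖ + √(lambdaMax P) * ‖w‖ := by gcongr
    _ ≤ max 1 √(lambdaMax P) * ‖y‖ + max 1 √(lambdaMax P) * ‖w‖ := by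
        gcongr
        · exact le_max_left _ _
        · exact le_max_right _ _
    _ = max 1 √(lambdaMax P) * (‖y‖ + ‖w‖) := by ring
    _ ≤ max 1 √(lambdaMax P) * (√2 * pairNorm y w) := by gcongr
    _ = slope₂ P * pairNorm y w := by rw [slope₂]; ring

/-- The radius of `S₂` is made for this: whatever the input does inside `S₂`, the level `α₁(r_s)` is
not reached there. -/
theorem lyap_lt_of_mem_S2 (hq : 0 < q) (hP : P.PosDef) {rs : ℝ} {x : Vec k × Vec q}
    (hx : x ∈ S2 k P rs) : lyap P x.1 x.2 < slope₁ P * rs := by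
  have h1 : pairNorm x.1 x.2 < slope₁ P * rs / slope₂ P := hx
  rw [lt_div_iff₀ slope₂_pos] at h1
  have := lyap_le_slope₂_mul hq hP x.1 x.2
  linarith

theorem continuous_lyap : Continuous fun x : Vec k × Vec q => lyap P x.1 x.2 := by
  simp only [lyap_eq]
  exact continuous_fst.norm.add (continuous_wnorm.comp continuous_snd)

end Geometry

/-- What the analysis of the event-triggered loop uses about the plant, the controller and the
Lyapunov function on the set `S_v`. -/
structure LoopSetting {k q m : ℕ} (S : Plant k q m) (K : Feedback k q m)
    (E : Matrix (Fin q) (Fin k) ℝ) (h ha : Vec k → Vec q) (P : Matrix (Fin q) (Fin q) ℝ)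
    (σ p cy cw δ rs ρ : ℝ) : Prop where
  q_pos : 0 < q
  manifold : IsCenterManifold S K E h ρ
  approx_cont : Continuous ha
  approx_zero : ha 0 = 0
  posDef : P.PosDef
  σ_pos : 0 < σ
  p_pos : 0 < p
  cy_pos : 0 < cy
  cw_pos : 0 < cw
  δ_pos : 0 < δ
  δ_lt : δ < ρ
  decreases : DecreasesOn S K E h ha P σ p cy cw δ
  rs_pos : 0 < rs
  rs_lt : rs < δ

variable {k q m : ℕ} {S : Plant k q m} {K : Feedback k q m}
  {E : Matrix (Fin q) (Fin k) ℝ} {h ha : Vec k → Vec q} {P : Matrix (Fin q) (Fin q) ℝ}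
  {σ p cy cw δ rs ρ : ℝ}

/-- At time `s` the signals follow the plant with some input, and in `S_v \ S₂` this input is
the feedback for a measurement which satisfies the error bound. -/
def DrivenAt (S : Plant k q m) (K : Feedback k q m) (E : Matrix (Fin q) (Fin k) ℝ)
    (h ha : Vec k → Vec q) (P : Matrix (Fin q) (Fin q) ℝ) (σ p δ rs : ℝ)
    (y : ℝ → Vec k) (z : ℝ → Vec q) (s : ℝ) : Prop :=
  ∃ u, FollowsAt S y z s u ∧ (toYW E h (y s) (z s) ∈ Sv k P δ \ S2 k P rs →
    ∃ y' z', u = K.law y' z' ∧ pairNorm (y' - y s) ((z' - act E y') - (z s - act E (y s)))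
      ≤ σ * (‖z s - act E (y s) - ha (y s)‖ + ‖y s‖ ^ (p + 1)))

namespace LoopSetting

variable (L : LoopSetting S K E h ha P σ p cy cw δ rs ρ)

include L

theorem norm_fst_lt {x : Vec k × Vec q} (hx : pairNorm x.1 x.2 ≤ δ) : ‖x.1‖ < ρ :=
  ((norm_le_pairNorm_left _ _).trans hx).trans_lt L.δ_lt

theorem threshold_pos : 0 < slope₁ P * rs / slope₂ P :=
  div_pos (mul_pos (slope₁_pos L.q_pos L.posDef) L.rs_pos) slope₂_pos

theorem exists_rate : ∃ c > 0, ∀ x : Vec k × Vec q, x ∉ S2 k P rs →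
    c < cy * ‖x.1‖ ^ p + cw * ‖x.2‖ := by
  have hr := L.threshold_pos
  set r := slope₁ P * rs / slope₂ P with hr_def
  have hcy := L.cy_pos
  have hcw := L.cw_pos
  -- Outside `S₂` one of `‖y‖`, `‖w‖` is at least `r / 2`. The final halving gives the strict
  -- inequality that the comparison argument needs.
  refine ⟨min (cy * (r / 2) ^ p) (cw * (r / 2)) / 2, by positivity, fun x hx => ?_⟩
  have h1 : r ≤ pairNorm x.1 x.2 := not_lt.1 hx
  have h2 := h1.trans (pairNorm_le_add x.1 x.2)
  have h3 : 0 < min (cy * (r / 2) ^ p) (cw * (r / 2)) := by positivity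
  have h4 : 0 ≤ cy * ‖x.1‖ ^ p := by positivity
  have h5 : 0 ≤ cw * ‖x.2‖ := by positivity
  rcases le_total (r / 2) ‖x.1‖ with h6 | h6
  · have h7 : cy * (r / 2) ^ p ≤ cy * ‖x.1‖ ^ p :=
      mul_le_mul_of_nonneg_left (Real.rpow_le_rpow (by positivity) h6 L.p_pos.le) hcy.le
    linarith [min_le_left (cy * (r / 2) ^ p) (cw * (r / 2))]
  · have h7 : cw * (r / 2) ≤ cw * ‖x.2‖ := mul_le_mul_of_nonneg_left (by linarith) hcw.le
    linarith [min_le_right (cy * (r / 2) ^ p) (cw * (r / 2))]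

theorem continuousWithinAt_toYW {y : ℝ → Vec k} {z : ℝ → Vec q} {s : Set ℝ} {t : ℝ}
    (hy : ContinuousWithinAt y s t) (hz : ContinuousWithinAt z s t) (hyt : ‖y t‖ < ρ) :
    ContinuousWithinAt (fun t => toYW E h (y t) (z t)) s t :=
  hy.prodMk ((hz.sub ((continuous_act E).continuousAt.comp_continuousWithinAt hy)).sub
    ((L.manifold.hasFDerivAt S K E hyt).continuousAt.comp_continuousWithinAt hy))

/-- The subgradients that realize the right derivatives of the two summands pair to a subgradient of
`V`, so the decrease condition applies even where `V` is not smooth. -/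
theorem exists_hasDerivWithinAt_lyap {y : ℝ → Vec k} {z : ℝ → Vec q} {t : ℝ}
    (hlt : pairNorm (toYW E h (y t) (z t)).1 (toYW E h (y t) (z t)).2 < δ)
    (hd : DrivenAt S K E h ha P σ p δ rs y z t) :
    ∃ d, HasDerivWithinAt
        (fun s => lyap P (toYW E h (y s) (z s)).1 (toYW E h (y s) (z s)).2) d (Ici t) t ∧
      (toYW E h (y t) (z t) ∈ Sv k P δ \ S2 k P rs → d ≤
        -(cy * ‖(toYW E h (y t) (z t)).1‖ ^ p + cw * ‖(toYW E h (y t) (z t)).2‖)) := by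
  obtain ⟨u, ⟨hy, hz⟩, hu⟩ := hd
  have hyρ : ‖y t‖ < ρ := L.norm_fst_lt (x := toYW E h (y t) (z t)) hlt.le
  have hw : HasDerivWithinAt (fun s => (toYW E h (y s) (z s)).2)
      (S.zField (y t) (z t) u - act E (S.yField (y t) (z t) u)
        - fderiv ℝ h (y t) (S.yField (y t) (z t) u)) (Ici t) t :=
    (hz.sub ((actL E).hasFDerivAt.comp_hasDerivWithinAt t hy)).sub
      ((L.manifold.hasFDerivAt S K E hyρ).comp_hasDerivWithinAt t hy)
  obtain ⟨ζ₁, hζ₁, hd₁⟩ := exists_subgradient_hasDerivWithinAt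
    (M := (1 : Matrix (Fin k) (Fin k) ℝ)) Matrix.PosDef.one hy
  obtain ⟨ζ₂, hζ₂, hd₂⟩ := exists_subgradient_hasDerivWithinAt L.posDef hw
  simp only [wnorm_one] at hζ₁ hd₁
  refine ⟨_, hd₁.add hd₂, fun hmem => ?_⟩
  obtain ⟨y', z', rfl, he⟩ := hu hmem
  have hζ : (ζ₁, ζ₂) ∈ lyapSubdiff P (y t) (toYW E h (y t) (z t)).2 := fun a b => by
    have h1 := hζ₁ a
    have h2 := hζ₂ b
    simp only [lyap_eq]
    linarith
  have e1 : (toYW E h (y t) (z t)).2 + h (y t) = z t - act E (y t) := by simp [toYW]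
  have hdec := L.decreases (y t) (toYW E h (y t) (z t)).2 (y' - y t)
    ((z' - act E y') - (z t - act E (y t))) hlt (by rwa [e1]) _ hζ
  have e2 : yRate S K E (y t) (z t - act E (y t)) (y' - y t)
      ((z' - act E y') - (z t - act E (y t))) = S.yField (y t) (z t) (K.law y' z') := by
    simp only [yRate, sub_add_cancel, add_sub_cancel]
  have e3 : vRate S K E (y t) (z t - act E (y t)) (y' - y t)
      ((z' - act E y') - (z t - act E (y t))) = S.zField (y t) (z t) (K.law y' z')
        - act E (S.yField (y t) (z t) (K.law y' z')) := by
    rw [vRate, e2]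
    simp only [sub_add_cancel, add_sub_cancel]
  rw [wRate, e1, e2, e3] at hdec
  exact hdec

-- At the corner the affine part continues below `B` to the right, hence the right derivative `0`
-- there.
omit L in
theorem hasDerivWithinAt_max_affine (A B c a t : ℝ) (hc : 0 < c) :
    HasDerivWithinAt (fun s => max (A - c * (s - a)) B)
      (if B < A - c * (t - a) then -c else 0) (Ici t) t := by
  split_ifs with hlt
  · have hd : HasDerivWithinAt (fun s => A - c * (s - a)) (-c) (Ici t) t := by
      have := (((hasDerivAt_id t).sub_const a).const_mul c).const_sub A
      simpa using this.hasDerivWithinAt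
    refine hd.congr_of_eventuallyEq ?_ (max_eq_left hlt.le)
    have hc : ContinuousAt (fun s => A - c * (s - a)) t := by fun_prop
    filter_upwards [nhdsWithin_le_nhds (hc.eventually_const_lt hlt)] with s hs
    exact max_eq_left hs.le
  · rw [not_lt] at hlt
    refine (hasDerivWithinAt_const t (Ici t) B).congr (fun s hs => max_eq_right ?_)
      (max_eq_right hlt)
    nlinarith [mem_Ici.1 hs]

theorem level_lt : slope₁ P * rs < slope₁ P * δ :=
  mul_lt_mul_of_pos_left L.rs_lt (slope₁_pos L.q_pos L.posDef)

/-- As long as a driven curve stays in `‖(y; w)‖ < δ`, the Lyapunov function decreases at a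
uniform rate down to the level `α₁(r_s)`. -/
theorem lyap_le_of_driven_of_lt {c : ℝ} (hc : 0 < c)
    (hrate : ∀ x : Vec k × Vec q, x ∉ S2 k P rs → c < cy * ‖x.1‖ ^ p + cw * ‖x.2‖)
    {y : ℝ → Vec k} {z : ℝ → Vec q} {a b : ℝ}
    (hcont : ContinuousOn (fun s => toYW E h (y s) (z s)) (Icc a b))
    (ha₀ : toYW E h (y a) (z a) ∈ Sv k P δ)
    (hin : ∀ s ∈ Ico a b, pairNorm (toYW E h (y s) (z s)).1 (toYW E h (y s) (z s)).2 < δ)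
    (hd : ∀ s ∈ Ico a b, DrivenAt S K E h ha P σ p δ rs y z s) :
    ∀ s ∈ Icc a b, lyap P (toYW E h (y s) (z s)).1 (toYW E h (y s) (z s)).2
      ≤ max (slope₁ P * δ - c * (s - a)) (slope₁ P * rs) := by
  have hlvl := L.level_lt
  have hder : ∀ s ∈ Ico a b, _ := fun s hs =>
    L.exists_hasDerivWithinAt_lyap (hin s hs) (hd s hs)
  have hV := (continuous_lyap (P := P)).comp_continuousOn hcont
  generalize hx : (fun s => toYW E h (y s) (z s)) = x at hcont hV
  have hx' : ∀ s, toYW E h (y s) (z s) = x s := fun s => congrFun hx s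
  simp only [hx'] at ha₀ hin hder ⊢
  choose! d hd1 hd2 using hder
  -- Slopes need comparing only where `V` equals the bound. There `V ≥ α₁(r_s)` excludes `S₂` and `V
  -- ≤ α₁(δ)` gives `S_v`, so the decrease estimate is available.
  refine image_le_of_liminf_slope_right_lt_deriv_boundary' (f' := d)
    (f := fun s => lyap P (x s).1 (x s).2)
    (B' := fun t => if slope₁ P * rs < slope₁ P * δ - c * (t - a) then -c else 0)
    hV (fun s hs r hr => (hd1 s hs).liminf_right_slope_le hr) ?_ (by fun_prop)
    (fun s _ => hasDerivWithinAt_max_affine _ _ c a s hc) (fun s hs heq => ?_)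
  · simp only [sub_self, mul_zero, sub_zero]
    exact ha₀.2.trans (le_max_left _ _)
  · have hge : slope₁ P * rs ≤ lyap P (x s).1 (x s).2 := heq ▸ le_max_right _ _
    have hnot : x s ∉ S2 k P rs := fun hm =>
      (lyap_lt_of_mem_S2 L.q_pos L.posDef hm).not_ge hge
    have hle : lyap P (x s).1 (x s).2 ≤ slope₁ P * δ := by
      rw [heq]
      exact max_le (by nlinarith [hs.1]) hlvl.le
    have h1 := hd2 s hs ⟨⟨hin s hs, hle⟩, hnot⟩
    have h2 := hrate _ hnot
    split_ifs <;> linarith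

/-- A driven curve which starts in `S_v` stays in `‖(y; w)‖ < δ`. -/
theorem pairNorm_lt_of_driven
    {y : ℝ → Vec k} {z : ℝ → Vec q} {a b : ℝ}
    (hy : ContinuousOn y (Icc a b)) (hz : ContinuousOn z (Icc a b))
    (ha₀ : toYW E h (y a) (z a) ∈ Sv k P δ)
    (hd : ∀ s ∈ Ico a b, pairNorm (toYW E h (y s) (z s)).1 (toYW E h (y s) (z s)).2 < δ →
      DrivenAt S K E h ha P σ p δ rs y z s) :
    ∀ s ∈ Icc a b, pairNorm (toYW E h (y s) (z s)).1 (toYW E h (y s) (z s)).2 < δ := by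
  obtain ⟨c, hc, hrate⟩ := L.exists_rate
  have hsl := slope₁_pos L.q_pos L.posDef
  by_contra! hcon
  obtain ⟨s₁, hs₁m, hs₁⟩ := hcon
  set A := {s | s ∈ Icc a b ∧
    δ ≤ pairNorm (toYW E h (y s) (z s)).1 (toYW E h (y s) (z s)).2} with hA
  have hAne : A.Nonempty := ⟨s₁, hs₁m, hs₁⟩
  have hAbd : BddBelow A := ⟨a, fun s hs => hs.1.1⟩
  obtain ⟨t, ht⟩ : ∃ t, t = sInf A := ⟨_, rfl⟩
  have hat : a ≤ t := ht ▸ le_csInf hAne fun s hs => hs.1.1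
  have htb : t ≤ b := ht ▸ (csInf_le hAbd ⟨hs₁m, hs₁⟩).trans hs₁m.2
  have hsub : Icc a t ⊆ Icc a b := Icc_subset_Icc_right htb
  have hbefore : ∀ s ∈ Ico a t,
      pairNorm (toYW E h (y s) (z s)).1 (toYW E h (y s) (z s)).2 < δ := fun s hs => by
    by_contra hn
    have := csInf_le hAbd ⟨hsub (Ico_subset_Icc_self hs), not_lt.1 hn⟩
    exact (ht ▸ this).not_gt hs.2
  -- Here `t` is the first exit time. As `h` is regular only on the ball of radius `ρ`, continuity
  -- of `w` at `t` requires this bound, obtained as a limit of `‖y‖ ≤ δ < ρ`.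
  have hyt : ‖y t‖ < ρ := by
    rcases hat.eq_or_lt with heq | hlt
    · rw [← heq]; exact L.norm_fst_lt (x := toYW E h (y a) (z a)) ha₀.1.le
    · have hcl : t ∈ closure (Ico a t) := by
        rw [closure_Ico hlt.ne]; exact ⟨hat, le_rfl⟩
      have hyc : ContinuousWithinAt (fun s => ‖y s‖) (Ico a t) t :=
        ((hy t ⟨hat, htb⟩).mono (Ico_subset_Icc_self.trans hsub)).norm
      have : ‖y t‖ ≤ δ := ContinuousWithinAt.closure_le (f := fun s => ‖y s‖) hcl hyc
        (continuousWithinAt_const (b := δ)) (fun s hs =>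
          ((norm_le_pairNorm_left (y s) (toYW E h (y s) (z s)).2).trans_lt (hbefore s hs)).le)
      exact this.trans_lt L.δ_lt
  have hxt := L.continuousWithinAt_toYW (hy t ⟨hat, htb⟩) (hz t ⟨hat, htb⟩) hyt
  have hge : δ ≤ pairNorm (toYW E h (y t) (z t)).1 (toYW E h (y t) (z t)).2 := by
    by_contra hn
    have hev := (continuous_pairNorm.continuousAt.comp_continuousWithinAt hxt).eventually_lt_const
      (not_le.1 hn)
    obtain ⟨ε, hε, hball⟩ := Metric.mem_nhdsWithin_iff.1 hev
    obtain ⟨s, hsA, hst⟩ := exists_lt_of_csInf_lt hAne (show sInf A < t + ε by linarith)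
    have hts : t ≤ s := ht ▸ csInf_le hAbd hsA
    have hsb : s ∈ Metric.ball t ε := by
      rw [Metric.mem_ball, Real.dist_eq, abs_of_nonneg (by linarith)]; linarith
    exact not_le.2 (hball ⟨hsb, hsA.1⟩) hsA.2
  have hat' : a < t := by
    refine hat.lt_of_ne fun heq => ?_
    rw [← heq] at hge
    exact ha₀.1.not_ge hge
  have hcont : ContinuousOn (fun s => toYW E h (y s) (z s)) (Icc a t) := fun s hs => by
    have hys : ‖y s‖ < ρ := by
      rcases hs.2.eq_or_lt with heq | hlt
      · rwa [heq]
      · exact L.norm_fst_lt (x := toYW E h (y s) (z s)) (hbefore s ⟨hs.1, hlt⟩).le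
    exact L.continuousWithinAt_toYW ((hy s (hsub hs)).mono hsub) ((hz s (hsub hs)).mono hsub) hys
  -- Contradiction at the exit: since `t > a`, the bound on `V` is strictly below `α₁(δ)`, whereas
  -- norm at least `δ` forces `V ≥ α₁(δ)`.
  have h1 := L.lyap_le_of_driven_of_lt hc hrate hcont ha₀ hbefore
    (fun s hs => hd s ⟨hs.1, hs.2.trans_le htb⟩ (hbefore s hs)) t ⟨hat, le_rfl⟩
  have h2 := slope₁_mul_le_lyap L.q_pos L.posDef (toYW E h (y t) (z t)).1 (toYW E h (y t) (z t)).2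
  have h3 := mul_le_mul_of_nonneg_left hge hsl.le
  have h4 : max (slope₁ P * δ - c * (t - a)) (slope₁ P * rs) < slope₁ P * δ :=
    max_lt (by nlinarith) L.level_lt
  linarith

/-- A driven curve which starts in `S_v` stays there, and the Lyapunov function decreases at a
uniform rate down to the level `α₁(r_s)`. -/
theorem lyap_le_of_driven {c : ℝ} (hc : 0 < c)
    (hrate : ∀ x : Vec k × Vec q, x ∉ S2 k P rs → c < cy * ‖x.1‖ ^ p + cw * ‖x.2‖)
    {y : ℝ → Vec k} {z : ℝ → Vec q} {a b : ℝ}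
    (hy : ContinuousOn y (Icc a b)) (hz : ContinuousOn z (Icc a b))
    (ha₀ : toYW E h (y a) (z a) ∈ Sv k P δ)
    (hd : ∀ s ∈ Ico a b, pairNorm (toYW E h (y s) (z s)).1 (toYW E h (y s) (z s)).2 < δ →
      DrivenAt S K E h ha P σ p δ rs y z s) :
    ∀ s ∈ Icc a b, toYW E h (y s) (z s) ∈ Sv k P δ ∧
      lyap P (toYW E h (y s) (z s)).1 (toYW E h (y s) (z s)).2
        ≤ max (slope₁ P * δ - c * (s - a)) (slope₁ P * rs) := by
  have hin := L.pairNorm_lt_of_driven hy hz ha₀ hd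
  have hcont : ContinuousOn (fun s => toYW E h (y s) (z s)) (Icc a b) := fun s hs =>
    L.continuousWithinAt_toYW (hy s hs) (hz s hs)
      (L.norm_fst_lt (x := toYW E h (y s) (z s)) (hin s hs).le)
  intro s hs
  have h1 := L.lyap_le_of_driven_of_lt hc hrate hcont ha₀
    (fun s hs => hin s (Ico_subset_Icc_self hs))
    (fun s hs => hd s hs (hin s (Ico_subset_Icc_self hs))) s hs
  refine ⟨⟨hin s hs, h1.trans (max_le ?_ L.level_lt.le)⟩, h1⟩
  nlinarith [hs.1]

/-- The set of plant states with `‖(y; w)‖ ≤ δ` is contained in a compact set. -/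
theorem exists_isCompact : ∃ C : Set (Vec k × Vec q), IsCompact C ∧
    ∀ y z, pairNorm (toYW E h y z).1 (toYW E h y z).2 ≤ δ → (y, z) ∈ C := by
  have hb : Metric.closedBall (0 : Vec k) δ ⊆ Metric.ball 0 ρ :=
    Metric.closedBall_subset_ball L.δ_lt
  have hc : ContinuousOn (fun x : Vec k × Vec q => (x.1, x.2 + act E x.1 + h x.1))
      (Metric.closedBall 0 δ ×ˢ Metric.closedBall 0 δ) := by
    refine continuousOn_fst.prodMk ((continuousOn_snd.add
      ((continuous_act E).comp_continuousOn continuousOn_fst)).add ?_)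
    exact (L.manifold.continuousOn S K E).comp continuousOn_fst fun x hx => hb hx.1
  refine ⟨_, ((isCompact_closedBall 0 δ).prod (isCompact_closedBall 0 δ)).image_of_continuousOn hc,
    fun y z hyz => ⟨toYW E h y z, ⟨?_, ?_⟩, ?_⟩⟩
  · simpa using (norm_le_pairNorm_left _ _).trans hyz
  · simpa using (norm_le_pairNorm_right _ _).trans hyz
  · simp only [toYW, Prod.mk.injEq, true_and]
    abel

theorem exists_field_bound : ∃ M ≥ 0, ∀ y z y' z', toYW E h y z ∈ Sv k P δ →
    toYW E h y' z' ∈ Sv k P δ →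
    ‖S.yField y z (K.law y' z')‖ ≤ M ∧ ‖S.zField y z (K.law y' z')‖ ≤ M := by
  obtain ⟨C, hC, hCm⟩ := L.exists_isCompact
  have hmap : Continuous fun x : (Vec k × Vec q) × (Vec k × Vec q) =>
      ((x.1.1, x.1.2, K.law x.2.1 x.2.2) : Vec k × Vec q × Vec m) := by
    have := (contDiff_law K).continuous.comp
      (continuous_snd : Continuous fun x : (Vec k × Vec q) × (Vec k × Vec q) => x.2)
    exact (by fun_prop : Continuous fun x : (Vec k × Vec q) × (Vec k × Vec q) => x.1.1).prodMk
      ((by fun_prop : Continuous fun x : (Vec k × Vec q) × (Vec k × Vec q) => x.1.2).prodMk this)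
  obtain ⟨M₁, hM₁⟩ := (hC.prod hC).exists_bound_of_continuousOn
    ((contDiff_yField S).continuous.comp hmap).continuousOn
  obtain ⟨M₂, hM₂⟩ := (hC.prod hC).exists_bound_of_continuousOn
    ((contDiff_zField S).continuous.comp hmap).continuousOn
  refine ⟨max 0 (max M₁ M₂), le_max_left _ _, fun y z y' z' h1 h2 => ?_⟩
  have hm : ((y, z), (y', z')) ∈ C ×ˢ C := ⟨hCm y z h1.1.le, hCm y' z' h2.1.le⟩
  exact ⟨(hM₁ _ hm).trans ((le_max_left _ _).trans (le_max_right _ _)),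
    (hM₂ _ hm).trans ((le_max_right _ _).trans (le_max_right _ _))⟩

/-- On a compact shell the threshold is continuous and positive: for `y = 0` it equals `‖w‖`,
because `h` and `hᵃ` vanish at `0`. Removing `S₂` is what keeps it away from zero. -/
theorem exists_threshold_bound : ∃ η > 0, ∀ y z, toYW E h y z ∈ Sv k P δ \ S2 k P rs →
    η ≤ ‖z - act E y - ha y‖ + ‖y‖ ^ (p + 1) := by
  set D : Set (Vec k × Vec q) := {x | slope₁ P * rs / slope₂ P ≤ pairNorm x.1 x.2} ∩
    {x | pairNorm x.1 x.2 ≤ δ} with hD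
  have hDc : IsCompact D := by
    refine ((isCompact_closedBall (0 : Vec k) δ).prod
      (isCompact_closedBall (0 : Vec q) δ)).of_isClosed_subset
      ((isClosed_le continuous_const continuous_pairNorm).inter
        (isClosed_le continuous_pairNorm continuous_const)) fun x hx => ⟨?_, ?_⟩
    · simpa using (norm_le_pairNorm_left _ _).trans hx.2
    · simpa using (norm_le_pairNorm_right _ _).trans hx.2
  have hp := L.p_pos
  have hcont : ContinuousOn (fun x : Vec k × Vec q =>
      ‖x.2 + h x.1 - ha x.1‖ + ‖x.1‖ ^ (p + 1)) D := by
    refine ((continuousOn_snd.add ?_).sub (L.approx_cont.comp_continuousOn continuousOn_fst)).norm.add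
      ((continuousOn_fst.norm).rpow_const fun x _ => Or.inr (by linarith))
    exact (L.manifold.continuousOn S K E).comp continuousOn_fst fun x hx => by
      simpa using L.norm_fst_lt hx.2
  have hpos : ∀ x ∈ D, 0 < ‖x.2 + h x.1 - ha x.1‖ + ‖x.1‖ ^ (p + 1) := by
    intro x hx
    by_cases hx1 : x.1 = 0
    · have hx2 : x.2 ≠ 0 := fun hx2 => by
        have h1 : slope₁ P * rs / slope₂ P ≤ pairNorm x.1 x.2 := hx.1
        rw [hx1, hx2, pairNorm_zero] at h1
        exact L.threshold_pos.not_ge h1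
      rw [hx1, L.manifold.zero, L.approx_zero, add_zero, sub_zero]
      have := norm_pos_iff.2 hx2
      positivity
    · have := norm_pos_iff.2 hx1
      positivity
  obtain ⟨η, hη, hle⟩ := hDc.exists_forall_le' hcont hpos
  refine ⟨η, hη, fun y z hyz => ?_⟩
  have hge : slope₁ P * rs / slope₂ P ≤ pairNorm (toYW E h y z).1 (toYW E h y z).2 :=
    not_lt.1 fun hlt => hyz.2 hlt
  have hm : toYW E h y z ∈ D := ⟨hge, hyz.1.1.le⟩
  have := hle _ hm
  simpa [toYW] using this

/-- A uniform lower bound for the time between two events. -/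
theorem exists_gap : ∃ τmin > 0, ∀ (y : ℝ → Vec k) (z : ℝ → Vec q) (a b : ℝ), a ≤ b →
    ContinuousOn y (Icc a b) → ContinuousOn z (Icc a b) →
    (∀ s ∈ Ico a b, FollowsAt S y z s (K.law (y a) (z a))) →
    (∀ s ∈ Icc a b, toYW E h (y s) (z s) ∈ Sv k P δ) →
    toYW E h (y b) (z b) ∉ S2 k P rs → Triggers E ha σ p y z a b → a + τmin ≤ b := by
  obtain ⟨M, hM, hMb⟩ := L.exists_field_bound
  obtain ⟨η, hη, hηb⟩ := L.exists_threshold_bound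
  have hσ := L.σ_pos
  -- Growth rate of the error: `M` for `y`, `M + ‖E‖ M` for `v = z - E y`; the `1` keeps `N`
  -- positive. The error must climb from `0` to at least `σ η`.
  set N := M + (M + ‖actL E‖ * M) + 1 with hN
  have hNp : 0 < N := by positivity
  refine ⟨σ * η / N, by positivity, fun y z a b hab hy hz hf hin hout htr => ?_⟩
  have hstart := hin a ⟨le_rfl, hab⟩
  have hfb : ∀ s ∈ Ico a b, _ := fun s hs =>
    hMb (y s) (z s) (y a) (z a) (hin s (Ico_subset_Icc_self hs)) hstart
  have hyb := norm_image_sub_le_of_norm_deriv_right_le_segment hy (fun s hs => (hf s hs).1)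
    (fun s hs => (hfb s hs).1) b ⟨hab, le_rfl⟩
  have hzb := norm_image_sub_le_of_norm_deriv_right_le_segment hz (fun s hs => (hf s hs).2)
    (fun s hs => (hfb s hs).2) b ⟨hab, le_rfl⟩
  have h1 := hηb (y b) (z b) ⟨hin b ⟨hab, le_rfl⟩, hout⟩
  have h2 : σ * η ≤ pairNorm (y a - y b) ((z a - act E (y a)) - (z b - act E (y b))) :=
    (mul_le_mul_of_nonneg_left h1 hσ.le).trans htr
  have h3 : ‖(z a - act E (y a)) - (z b - act E (y b))‖ ≤ (M + ‖actL E‖ * M) * (b - a) := by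
    have e : (z a - act E (y a)) - (z b - act E (y b)) = -(z b - z a) + act E (y b - y a) := by
      rw [act_sub]; abel
    rw [e]
    refine (norm_add_le _ _).trans ?_
    rw [norm_neg]
    have := (actL E).le_opNorm (y b - y a)
    have h4 : ‖actL E‖ * ‖y b - y a‖ ≤ ‖actL E‖ * (M * (b - a)) := by gcongr
    have h5 : ‖act E (y b - y a)‖ ≤ ‖actL E‖ * ‖y b - y a‖ := this
    linarith
  rw [norm_sub_rev] at hyb
  have h4 := h2.trans (pairNorm_le_add _ _)
  have h5 : σ * η / N ≤ b - a := by
    rw [div_le_iff₀ hNp, hN]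
    linarith
  linarith

end LoopSetting

end

section

/-! ### Trajectories of the event-triggered loop -/

theorem IsFirstTime.le {D : Set ℝ} {a : EReal} (ha : IsFirstTime D a) {t : ℝ} (ht : t ∈ D) :
    a ≤ (t : EReal) := by
  rcases ha with ⟨r, hr, rfl⟩ | ⟨h, -⟩
  · exact EReal.coe_le_coe_iff.2 (hr.2 ht)
  · simp [h] at ht

theorem IsFirstTime.ne_bot {D : Set ℝ} {a : EReal} (ha : IsFirstTime D a) : a ≠ ⊥ := by
  rcases ha with ⟨r, -, rfl⟩ | ⟨-, rfl⟩ <;> simp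

theorem IsFirstTime.toReal_mem {D : Set ℝ} {a : EReal} (ha : IsFirstTime D a) (h : a ≠ ⊤) :
    a.toReal ∈ D := by
  rcases ha with ⟨r, hr, rfl⟩ | ⟨-, rfl⟩
  · exact hr.1
  · exact absurd rfl h

/-- Only times up to `a` matter, which lets an event of one piece be read as an event of the
concatenated curve. -/
theorem IsFirstTime.congr {D D' : Set ℝ} {a : EReal} (ha : IsFirstTime D a)
    (h : ∀ t : ℝ, (t : EReal) ≤ a → (t ∈ D ↔ t ∈ D')) : IsFirstTime D' a := by
  rcases ha with ⟨r, hr, rfl⟩ | ⟨hD, rfl⟩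
  · refine Or.inl ⟨r, ⟨(h r le_rfl).1 hr.1, fun t ht => ?_⟩, rfl⟩
    by_contra hlt
    exact hlt (hr.2 ((h t (EReal.coe_le_coe_iff.2 (not_le.1 hlt).le)).2 ht))
  · refine Or.inr ⟨eq_empty_of_forall_notMem fun t ht => ?_, rfl⟩
    have := (h t le_top).2 ht
    simp [hD] at this

variable {k q m : ℕ} {S : Plant k q m} {K : Feedback k q m}
  {E : Matrix (Fin q) (Fin k) ℝ} {h ha : Vec k → Vec q} {P : Matrix (Fin q) (Fin q) ℝ}
  {σ p cy cw δ rs ρ : ℝ}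

section Trajectory

variable {t₀ : ℝ} {T : EReal} {y : ℝ → Vec k} {z : ℝ → Vec q} {τ : ℕ → EReal}

theorem IsTrajectory.le_event {D : Set (Vec k × Vec q)}
    (htr : IsTrajectory S K E h ha σ p D t₀ T y z τ) (i : ℕ) : (t₀ : EReal) ≤ τ i := by
  induction i with
  | zero => exact htr.start.ge
  | succ i ih =>
    by_cases htop : τ (i + 1) = ⊤
    · rw [htop]; exact le_top
    rcases Nat.eq_zero_or_pos i with rfl | hi
    · have := htr.first_event.toReal_mem htop
      rw [← EReal.coe_toReal htop htr.first_event.ne_bot]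
      exact EReal.coe_le_coe_iff.2 this.1
    · have hf := htr.next_event i hi
      have := hf.toReal_mem htop
      rw [← EReal.coe_toReal htop hf.ne_bot]
      exact ih.trans this.1

/-- If the error bound failed in `S_v \ S₂`, the next event would already have happened. Before the
first event the state is not in that set. -/
theorem IsTrajectory.drivenAt
    (htr : IsTrajectory S K E h ha σ p (Sv k P δ \ S2 k P rs) t₀ T y z τ) {s : ℝ}
    (hs₀ : t₀ ≤ s) (hsT : (s : EReal) < T) : DrivenAt S K E h ha P σ p δ rs y z s := by
  have hex := htr.exhausts s hs₀ hsT
  classical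
  obtain ⟨i, hi, hmin⟩ : ∃ i, (s : EReal) < τ i ∧ ∀ j < i, τ j ≤ (s : EReal) :=
    ⟨Nat.find hex, Nat.find_spec hex, fun j hj => not_lt.1 (Nat.find_min hex hj)⟩
  match i, hi, hmin with
  | 0, hi, _ =>
    rw [htr.start] at hi
    exact absurd (EReal.coe_lt_coe_iff.1 hi) (not_lt.2 hs₀)
  | 1, hi, _ =>
    exact ⟨0, htr.zero_input s hs₀ hsT hi, fun hm =>
      absurd (htr.first_event.le ⟨hs₀, hsT, hm⟩) (not_le.2 hi)⟩
  | j + 2, hi, hmin =>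
    have hj := hmin (j + 1) (by omega)
    refine ⟨_, htr.held_input (j + 1) (by omega) s hj hsT hi, fun hm => ⟨_, _, rfl, ?_⟩⟩
    by_contra hn
    exact not_le.2 hi
      ((htr.next_event (j + 1) (by omega)).le ⟨hj, hsT, (not_le.1 hn).le, hm⟩)

end Trajectory

namespace LoopSetting

variable (L : LoopSetting S K E h ha P σ p cy cw δ rs ρ)

include L

/-- Trajectories which start in `S_v` stay there, are ultimately bounded, and have a positive
minimum time between events. -/
theorem exists_uniform_bounds : ∃ Tb : ℝ, 0 ≤ Tb ∧ ∃ τmin : ℝ, 0 < τmin ∧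
    ∀ (t₀ : ℝ) (T : EReal) (y : ℝ → Vec k) (z : ℝ → Vec q) (τ : ℕ → EReal),
      IsTrajectory S K E h ha σ p (Sv k P δ \ S2 k P rs) t₀ T y z τ →
      toYW E h (y t₀) (z t₀) ∈ Sv k P δ →
      (∀ t : ℝ, t₀ ≤ t → (t : EReal) < T → toYW E h (y t) (z t) ∈ Sv k P δ) ∧
      (∀ t : ℝ, t₀ + Tb ≤ t → (t : EReal) < T → toYW E h (y t) (z t) ∈ ballYW k q rs) ∧
      (∀ i : ℕ, 1 ≤ i → τ i + (τmin : EReal) ≤ τ (i + 1)) := by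
  obtain ⟨c, hc, hrate⟩ := L.exists_rate
  obtain ⟨τmin, hτmin, hgap⟩ := L.exists_gap
  have hs₁ := slope₁_pos L.q_pos L.posDef
  have hδ := L.δ_pos
  have hrs := L.rs_pos
  have hTb : 0 ≤ slope₁ P * δ / c := by positivity
  -- After time `α₁(δ) / c` the affine bound is nonpositive, so only the level `α₁(r_s)` remains.
  refine ⟨slope₁ P * δ / c, hTb, τmin, hτmin, fun t₀ T y z τ htr h₀ => ?_⟩
  have hcont : ∀ a b : ℝ, t₀ ≤ a → (b : EReal) < T →
      Icc a b ⊆ {t : ℝ | t₀ ≤ t ∧ (t : EReal) < T} := fun a b ha hb s hs =>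
    ⟨ha.trans hs.1, (EReal.coe_le_coe_iff.2 hs.2).trans_lt hb⟩
  have hmain : ∀ t : ℝ, t₀ ≤ t → (t : EReal) < T → _ := fun t ht htT =>
    L.lyap_le_of_driven hc hrate (htr.y_cont.mono (hcont t₀ t le_rfl htT))
      (htr.z_cont.mono (hcont t₀ t le_rfl htT)) h₀
      (fun s hs _ => htr.drivenAt hs.1 ((EReal.coe_lt_coe_iff.2 hs.2).trans htT)) t ⟨ht, le_rfl⟩
  refine ⟨fun t ht htT => (hmain t ht htT).1, fun t ht htT => ?_, fun i hi => ?_⟩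
  · have h1 := (hmain t (by linarith) htT).2
    have h2 : slope₁ P * δ - c * (t - t₀) ≤ slope₁ P * rs := by
      have : slope₁ P * δ ≤ (t - t₀) * c := (div_le_iff₀ hc).1 (by linarith)
      nlinarith
    rw [max_eq_right h2] at h1
    exact le_of_mul_le_mul_left ((slope₁_mul_le_lyap L.q_pos L.posDef _ _).trans h1) hs₁
  · have hf := htr.next_event i hi
    by_cases htop : τ (i + 1) = ⊤
    · rw [htop]; exact le_top
    obtain ⟨hle, hT, htrig, hmem⟩ := hf.toReal_mem htop
    have hb := EReal.coe_toReal htop hf.ne_bot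
    have hi₀ := htr.le_event i
    have ha_eq : ((τ i).toReal : EReal) = τ i := by
      refine EReal.coe_toReal (fun hc => ?_) (fun hc => ?_)
      · rw [hc] at hle; exact not_le.2 (EReal.coe_lt_top _) hle
      · rw [hc] at hi₀; exact not_le.2 (EReal.bot_lt_coe _) hi₀
    generalize (τ i).toReal = a at *
    generalize (τ (i + 1)).toReal = b at *
    rw [← ha_eq, EReal.coe_le_coe_iff] at hi₀ hle
    have hsub := hcont a b hi₀ hT
    have := hgap y z a b hle (htr.y_cont.mono hsub) (htr.z_cont.mono hsub)
      (fun s hs => by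
        have hh := htr.held_input i hi s (by rw [← ha_eq]; exact EReal.coe_le_coe_iff.2 hs.1)
          (hsub (Ico_subset_Icc_self hs)).2 (by rw [← hb]; exact EReal.coe_lt_coe_iff.2 hs.2)
        rwa [← ha_eq, EReal.toReal_coe] at hh)
      (fun s hs => (hmain s (hsub hs).1 (hsub hs).2).1) hmem.2 htrig
    rw [← ha_eq, ← hb, ← EReal.coe_add]
    exact EReal.coe_le_coe_iff.2 this

end LoopSetting

end

section

/-! ### Concatenation of curves -/

section Glue

variable {X : Type*} [TopologicalSpace X] {τ : ℕ → EReal} {α : ℕ → ℝ → X} {t₀ g : ℝ}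

theorem exists_lt_of_gap (hg : 0 < g) (h01 : (t₀ : EReal) ≤ τ 1)
    (hgap : ∀ i, 1 ≤ i → τ i + (g : EReal) ≤ τ (i + 1)) (t : ℝ) : ∃ i, (t : EReal) < τ (i + 1) := by
  have key : ∀ n : ℕ, ((t₀ + n * g : ℝ) : EReal) ≤ τ (n + 1) := by
    intro n
    induction n with
    | zero => simpa using h01
    | succ n ih =>
      refine le_trans ?_ (hgap (n + 1) (by omega))
      have : (t₀ + (n + 1 : ℕ) * g : ℝ) = (t₀ + n * g) + g := by push_cast; ring
      rw [this, EReal.coe_add]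
      exact add_le_add_left ih _
  obtain ⟨n, hn⟩ := exists_nat_gt ((t - t₀) / g)
  refine ⟨n, lt_of_lt_of_le (EReal.coe_lt_coe_iff.2 ?_) (key n)⟩
  rw [div_lt_iff₀ hg] at hn
  linarith

/-- Curves `α n` on `[τ n, τ (n + 1)]` which match at the end points form one continuous curve. -/
theorem exists_glue (hg : 0 < g) (h0 : τ 0 = t₀) (h01 : τ 0 ≤ τ 1) (hbot : ∀ i, τ i ≠ ⊥)
    (hgap : ∀ i, 1 ≤ i → τ i + (g : EReal) ≤ τ (i + 1)) (hα : ∀ n, Continuous (α n))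
    (hmatch : ∀ n, τ (n + 1) ≠ ⊤ → α (n + 1) (τ (n + 1)).toReal = α n (τ (n + 1)).toReal) :
    ∃ x : ℝ → X, (∀ (n : ℕ) (t : ℝ), τ n ≤ t → (t : EReal) ≤ τ (n + 1) → x t = α n t) ∧
      ContinuousOn x (Ici t₀) := by
  have hlt : ∀ i, 1 ≤ i → τ i ≠ ⊤ → τ i < τ (i + 1) := fun i hi htop => by
    refine lt_of_lt_of_le ?_ (hgap i hi)
    rw [← EReal.coe_toReal htop (hbot i), ← EReal.coe_add]
    exact EReal.coe_lt_coe_iff.2 (by linarith)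
  have hle : ∀ i, τ i ≤ τ (i + 1) := fun i => by
    rcases Nat.eq_zero_or_pos i with rfl | hi
    · exact h01
    · by_cases htop : τ i = ⊤
      · have := hgap i hi
        rw [htop, EReal.top_add_coe] at this
        rw [htop]; exact this
      · exact (hlt i hi htop).le
  have hmono : Monotone τ := monotone_nat_of_le_succ hle
  have hex := exists_lt_of_gap hg (h0 ▸ h01) hgap
  classical
  have hN : ∀ (n : ℕ) (t : ℝ), τ n ≤ t → (t : EReal) < τ (n + 1) → Nat.find (hex t) = n :=
    fun n t h1 h2 => (Nat.find_eq_iff _).2 ⟨h2, fun j hj =>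
      not_lt.2 ((hmono (show j + 1 ≤ n by omega)).trans h1)⟩
  obtain ⟨x, hx⟩ : ∃ x : ℝ → X, x = fun t => α (Nat.find (hex t)) t := ⟨_, rfl⟩
  have hxα : ∀ (n : ℕ) (t : ℝ), τ n ≤ t → (t : EReal) ≤ τ (n + 1) → x t = α n t := by
    intro n t h1 h2
    rcases h2.lt_or_eq with h2 | h2
    · rw [hx]; simp only [hN n t h1 h2]
    · have htop : τ (n + 1) ≠ ⊤ := by rw [← h2]; exact EReal.coe_ne_top t
      have h3 := hlt (n + 1) (by omega) htop
      have h4 := hmatch n htop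
      rw [← h2] at h3 h4
      rw [EReal.toReal_coe] at h4
      rw [hx, ← h4]
      simp only [hN (n + 1) t h2.ge h3]
  refine ⟨x, hxα, fun t ht => ?_⟩
  -- At a junction different pieces describe the two sides, so left and right continuity are proved
  -- separately.
  have hsplit : Ici t₀ = Icc t₀ t ∪ Ici t := (Icc_union_Ici_eq_Ici ht).symm
  rw [hsplit]
  refine ContinuousWithinAt.union ?_ ?_
  · rcases (mem_Ici.1 ht).eq_or_lt with heq | hlt'
    · rw [heq, Icc_self]
      exact continuousWithinAt_singleton
    · have hex' : ∃ i, (t : EReal) ≤ τ (i + 1) := (hex t).imp fun _ => le_of_lt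
      obtain ⟨n, hn1, hn2⟩ : ∃ n, τ n < (t : EReal) ∧ (t : EReal) ≤ τ (n + 1) := by
        refine ⟨Nat.find hex', ?_, Nat.find_spec hex'⟩
        rcases hfi : Nat.find hex' with _ | j
        · rw [h0]; exact EReal.coe_lt_coe_iff.2 hlt'
        · exact not_le.1 (Nat.find_min hex' (by omega))
      refine (hα n).continuousWithinAt.congr_of_eventuallyEq ?_ (hxα n t hn1.le hn2)
      filter_upwards [self_mem_nhdsWithin, nhdsWithin_le_nhds
        (continuous_coe_real_ereal.continuousAt.eventually_const_lt hn1)] with s hs hs'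
      exact hxα n s hs'.le ((EReal.coe_le_coe_iff.2 hs.2).trans hn2)
  · have hf := Nat.find_spec (hex t)
    have hτt : τ (Nat.find (hex t)) ≤ (t : EReal) := by
      rcases hfi : Nat.find (hex t) with _ | j
      · rw [h0]; exact EReal.coe_le_coe_iff.2 ht
      · exact not_lt.1 (Nat.find_min (hex t) (by omega))
    refine (hα (Nat.find (hex t))).continuousWithinAt.congr_of_eventuallyEq ?_ (hxα _ t hτt hf.le)
    filter_upwards [self_mem_nhdsWithin, nhdsWithin_le_nhds
        (continuous_coe_real_ereal.continuousAt.eventually_lt_const hf)] with s hs hs'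
    exact hxα _ s (hτt.trans (EReal.coe_le_coe_iff.2 hs)) hs'.le

end Glue

variable {k q m : ℕ} {S : Plant k q m} {K : Feedback k q m}
  {E : Matrix (Fin q) (Fin k) ℝ} {h ha : Vec k → Vec q} {P : Matrix (Fin q) (Fin q) ℝ}
  {σ p cy cw δ rs ρ : ℝ}

theorem FollowsAt.congr {y y' : ℝ → Vec k} {z z' : ℝ → Vec q} {t : ℝ} {u : Vec m}
    (hf : FollowsAt S y z t u) (hy : y' =ᶠ[𝓝[Ici t] t] y) (hz : z' =ᶠ[𝓝[Ici t] t] z) :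
    FollowsAt S y' z' t u := by
  have hyt := hy.eq_of_nhdsWithin self_mem_Ici
  have hzt := hz.eq_of_nhdsWithin self_mem_Ici
  refine ⟨?_, ?_⟩
  · rw [hyt, hzt]
    exact hf.1.congr_of_eventuallyEq hy hyt
  · rw [hyt, hzt]
    exact hf.2.congr_of_eventuallyEq hz hzt

theorem isClosed_triggers (hha : Continuous ha) (hp : 0 < p) {y : ℝ → Vec k} {z : ℝ → Vec q}
    (hy : Continuous y) (hz : Continuous z) (a : ℝ) :
    IsClosed {t | Triggers E ha σ p y z a t} := by
  have h1 : Continuous fun t => z t - act E (y t) := hz.sub ((continuous_act E).comp hy)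
  have h2 : Continuous fun t => σ * (‖z t - act E (y t) - ha (y t)‖ + ‖y t‖ ^ (p + 1)) :=
    continuous_const.mul ((h1.sub (hha.comp hy)).norm.add
      (hy.norm.rpow_const fun t => Or.inr (by linarith)))
  have h3 : Continuous fun t => pairNorm (y a - y t) (z a - act E (y a) - (z t - act E (y t))) :=
    (((continuous_const.sub hy).norm.pow 2).add ((continuous_const.sub h1).norm.pow 2)).sqrt
  exact isClosed_le h2 h3

namespace LoopSetting

variable (L : LoopSetting S K E h ha P σ p cy cw δ rs ρ)

include L

/-- For a constant input there is a curve on the whole time axis which follows the plant as long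
as it is in `‖(y; w)‖ < δ`. -/
theorem exists_curve (u : Vec m) (a : ℝ) (x₀ : Vec k × Vec q) :
    ∃ α : ℝ → Vec k × Vec q, α a = x₀ ∧ Continuous α ∧
      ∀ t, pairNorm (toYW E h (α t).1 (α t).2).1 (toYW E h (α t).1 (α t).2).2 < δ →
        FollowsAt S (fun t => (α t).1) (fun t => (α t).2) t u := by
  obtain ⟨C, hC, hCm⟩ := L.exists_isCompact
  obtain ⟨R, hR, hCR⟩ := hC.isBounded.subset_closedBall_lt 0 (0 : Vec k × Vec q)
  -- The cut-off is `1` on a ball containing all states with `‖(y; w)‖ ≤ δ`, so the field is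
  -- unchanged there and becomes complete.
  let f : ContDiffBump (0 : Vec k × Vec q) := ⟨R, R + 1, hR, by linarith⟩
  have hi : ContDiff ℝ 1 (fun x : Vec k × Vec q => (x.1, x.2, u)) := by fun_prop
  have hF : ContDiff ℝ 1 (fun x : Vec k × Vec q =>
      f x • (S.yField x.1 x.2 u, S.zField x.1 x.2 u)) := by
    have h1 := (contDiff_yField S).comp hi
    have h2 := (contDiff_zField S).comp hi
    exact f.contDiff.smul (h1.prodMk h2)
  have hFs : HasCompactSupport (fun x : Vec k × Vec q =>
      f x • (S.yField x.1 x.2 u, S.zField x.1 x.2 u)) := f.hasCompactSupport.smul_right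
  obtain ⟨α, hα0, hα⟩ := exists_global_solution hF hFs a x₀
  refine ⟨α, hα0, continuous_iff_continuousAt.2 fun t => (hα t).continuousAt, fun t ht => ?_⟩
  have h1 := hα t
  rw [f.one_of_mem_closedBall (hCR (hCm _ _ ht.le)), one_smul] at h1
  exact ⟨hasDerivWithinAt_fst h1.hasDerivWithinAt, hasDerivWithinAt_snd h1.hasDerivWithinAt⟩

/-- A curve with constant input `u` stays in `S_v` and follows the plant up to the first time in
`S_v \ S₂` that belongs to the closed set `G`, when `u` is admissible outside of `G`. -/
theorem exists_first_time {u : Vec m} {a : ℝ} {α : ℝ → Vec k × Vec q} (hα : Continuous α)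
    (hfol : ∀ t, pairNorm (toYW E h (α t).1 (α t).2).1 (toYW E h (α t).1 (α t).2).2 < δ →
        FollowsAt S (fun t => (α t).1) (fun t => (α t).2) t u)
    (h₀ : toYW E h (α a).1 (α a).2 ∈ Sv k P δ) {G : Set ℝ} (hG : IsClosed G)
    (hadm : ∀ s, a ≤ s → s ∉ G → toYW E h (α s).1 (α s).2 ∈ Sv k P δ \ S2 k P rs →
      ∃ y' z', u = K.law y' z' ∧
        pairNorm (y' - (α s).1) ((z' - act E y') - ((α s).2 - act E (α s).1))
        ≤ σ * (‖(α s).2 - act E (α s).1 - ha (α s).1‖ + ‖(α s).1‖ ^ (p + 1))) :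
    ∃ b : EReal, IsFirstTime {t : ℝ | a ≤ t ∧ t ∈ G ∧
        toYW E h (α t).1 (α t).2 ∈ Sv k P δ \ S2 k P rs} b ∧
      (∀ t : ℝ, a ≤ t → (t : EReal) ≤ b → toYW E h (α t).1 (α t).2 ∈ Sv k P δ) ∧
      ∀ t : ℝ, a ≤ t → (t : EReal) < b →
        FollowsAt S (fun t => (α t).1) (fun t => (α t).2) t u := by
  obtain ⟨c, hc, hrate⟩ := L.exists_rate
  set A := {t : ℝ | a ≤ t ∧ t ∈ G ∧ toYW E h (α t).1 (α t).2 ∈ Sv k P δ \ S2 k P rs} with hA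
  have hstay : ∀ b : ℝ, (∀ s ∈ Ico a b, s ∉ A) → ∀ t ∈ Icc a b,
      toYW E h (α t).1 (α t).2 ∈ Sv k P δ := by
    intro b hb t ht
    refine (L.lyap_le_of_driven (y := fun t => (α t).1) (z := fun t => (α t).2) hc hrate
      hα.fst.continuousOn hα.snd.continuousOn h₀ (fun s hs hlt => ?_) t ht).1
    exact ⟨u, hfol s hlt, fun hm => hadm s hs.1 (fun hsG => hb s hs ⟨hs.1, hsG, hm⟩) hm⟩
  by_cases hne : A.Nonempty
  · have hbd : BddBelow A := ⟨a, fun s hs => hs.1⟩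
    obtain ⟨t, ht⟩ : ∃ t, t = sInf A := ⟨_, rfl⟩
    have hat : a ≤ t := ht ▸ le_csInf hne fun s hs => hs.1
    have hin := hstay t fun s hs hsA => not_lt.2 (ht ▸ csInf_le hbd hsA) hs.2
    -- The infimum is attained although `S_v` is not closed: membership in `S_v` comes from
    -- invariance, the other two conditions pass to the limit.
    have htA : t ∈ A := by
      have hcl : t ∈ closure A := ht ▸ csInf_mem_closure hne hbd
      refine ⟨hat, closure_minimal (fun s hs => hs.2.1) hG hcl, hin t ⟨hat, le_rfl⟩, fun hS2 => ?_⟩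
      have hcx : ContinuousWithinAt (fun t => toYW E h (α t).1 (α t).2) univ t :=
        L.continuousWithinAt_toYW (y := fun t => (α t).1) (z := fun t => (α t).2)
          hα.fst.continuousWithinAt hα.snd.continuousWithinAt
          (L.norm_fst_lt (x := toYW E h (α t).1 (α t).2) (hin t ⟨hat, le_rfl⟩).1.le)
      rw [continuousWithinAt_univ] at hcx
      have hev := (continuous_pairNorm.continuousAt.comp hcx).eventually_lt_const hS2
      obtain ⟨s, hs1, hs2⟩ := mem_closure_iff_nhds.1 hcl _ hev
      exact hs2.2.2.2 hs1
    refine ⟨t, Or.inl ⟨t, ⟨htA, fun s hs => ht ▸ csInf_le hbd hs⟩, rfl⟩, fun s hs hst => ?_,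
      fun s hs hst => ?_⟩
    · exact hin s ⟨hs, EReal.coe_le_coe_iff.1 hst⟩
    · exact hfol s (hin s ⟨hs, (EReal.coe_lt_coe_iff.1 hst).le⟩).1
  · rw [not_nonempty_iff_eq_empty] at hne
    have hin : ∀ s, a ≤ s → toYW E h (α s).1 (α s).2 ∈ Sv k P δ := fun s hs =>
      hstay s (fun r _ hr => by simp [hne] at hr) s ⟨hs, le_rfl⟩
    exact ⟨⊤, Or.inr ⟨hne, rfl⟩, fun s hs _ => hin s hs, fun s hs _ => hfol s (hin s hs).1⟩

/-- The curve before the first event. -/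
theorem exists_initial_piece (a : ℝ) {x₀ : Vec k × Vec q} (h₀ : toYW E h x₀.1 x₀.2 ∈ Sv k P δ) :
    ∃ (α : ℝ → Vec k × Vec q) (b : EReal), α a = x₀ ∧ Continuous α ∧
      IsFirstTime {t : ℝ | a ≤ t ∧ toYW E h (α t).1 (α t).2 ∈ Sv k P δ \ S2 k P rs} b ∧
      ∀ t : ℝ, a ≤ t → (t : EReal) < b →
        FollowsAt S (fun t => (α t).1) (fun t => (α t).2) t 0 := by
  obtain ⟨α, hα0, hαc, hα⟩ := L.exists_curve 0 a x₀
  -- With `G = univ` the event is the first entry into `S_v \ S₂`, and admissibility of the zero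
  -- input is vacuous.
  obtain ⟨b, hb, -, hf⟩ := L.exists_first_time hαc hα (by rwa [hα0]) isClosed_univ
    (fun s _ hs => absurd (mem_univ s) hs)
  exact ⟨α, b, hα0, hαc, by simpa using hb, hf⟩

/-- The curve from an event at time `a` to the next one. -/
theorem exists_held_piece {g : ℝ}
    (hgap : ∀ (y : ℝ → Vec k) (z : ℝ → Vec q) (a b : ℝ), a ≤ b →
      ContinuousOn y (Icc a b) → ContinuousOn z (Icc a b) →
      (∀ s ∈ Ico a b, FollowsAt S y z s (K.law (y a) (z a))) →
      (∀ s ∈ Icc a b, toYW E h (y s) (z s) ∈ Sv k P δ) →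
      toYW E h (y b) (z b) ∉ S2 k P rs → Triggers E ha σ p y z a b → a + g ≤ b)
    {a : EReal} (hbot : a ≠ ⊥) {x₀ : Vec k × Vec q}
    (h₀ : a ≠ ⊤ → toYW E h x₀.1 x₀.2 ∈ Sv k P δ) :
    ∃ (α : ℝ → Vec k × Vec q) (b : EReal), α a.toReal = x₀ ∧ Continuous α ∧
      IsFirstTime {t : ℝ | a ≤ t ∧
        Triggers E ha σ p (fun t => (α t).1) (fun t => (α t).2) a.toReal t ∧
        toYW E h (α t).1 (α t).2 ∈ Sv k P δ \ S2 k P rs} b ∧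
      a + (g : EReal) ≤ b ∧
      ∀ t : ℝ, a ≤ t → (t : EReal) < b →
        FollowsAt S (fun t => (α t).1) (fun t => (α t).2) t (K.law x₀.1 x₀.2) := by
  by_cases htop : a = ⊤
  -- A dummy piece after the last event keeps the recursion total.
  · refine ⟨fun _ => x₀, ⊤, rfl, continuous_const, Or.inr ⟨?_, rfl⟩, le_top, fun t ht => ?_⟩
    · simp [htop]
    · simp [htop] at ht
  lift a to ℝ using ⟨htop, hbot⟩
  simp only [EReal.toReal_coe, EReal.coe_le_coe_iff]
  obtain ⟨α, hα0, hαc, hα⟩ := L.exists_curve (K.law x₀.1 x₀.2) a x₀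
  have hG := isClosed_triggers L.approx_cont L.p_pos (σ := σ) (E := E) hαc.fst hαc.snd a
  obtain ⟨b, hb, hin, hf⟩ := L.exists_first_time hαc hα (by rw [hα0]; exact h₀ htop) hG
    (fun s _ hs _ => ⟨x₀.1, x₀.2, rfl, by
      have hs' : ¬Triggers E ha σ p (fun t => (α t).1) (fun t => (α t).2) a s := hs
      rw [Triggers, not_le, hα0] at hs'
      exact hs'.le⟩)
  refine ⟨α, b, hα0, hαc, hb, ?_, hf⟩
  by_cases hbt : b = ⊤
  · rw [hbt]; exact le_top
  obtain ⟨hab, htrig, hmem⟩ := hb.toReal_mem hbt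
  have hbr := EReal.coe_toReal hbt hb.ne_bot
  generalize b.toReal = r at *
  rw [← hbr, ← EReal.coe_add, EReal.coe_le_coe_iff]
  refine hgap (fun t => (α t).1) (fun t => (α t).2) a r hab hαc.fst.continuousOn
    hαc.snd.continuousOn (fun s hs => ?_) (fun s hs => hin s hs.1 ?_) hmem.2 htrig
  · simp only [hα0]
    exact hf s hs.1 (by rw [← hbr]; exact EReal.coe_lt_coe_iff.2 hs.2)
  · rw [← hbr]; exact EReal.coe_le_coe_iff.2 hs.2

/-- From every initial state in `S_v` there is a trajectory for all later times. -/
theorem exists_trajectory (t₀ : ℝ) (y₀ : Vec k) (z₀ : Vec q)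
    (h₀ : toYW E h y₀ z₀ ∈ Sv k P δ) :
    ∃ (y : ℝ → Vec k) (z : ℝ → Vec q) (τ : ℕ → EReal), y t₀ = y₀ ∧ z t₀ = z₀ ∧
      IsTrajectory S K E h ha σ p (Sv k P δ \ S2 k P rs) t₀ ⊤ y z τ := by
  obtain ⟨g, hg, hgap⟩ := L.exists_gap
  obtain ⟨α₀, b₀, hα₀, hα₀c, hb₀, hf₀⟩ := L.exists_initial_piece t₀ (x₀ := (y₀, z₀)) h₀
  -- A recursion state is a piece together with the event that ends it; the next piece starts from
  -- the value there.
  let St := {s : (ℝ → Vec k × Vec q) × EReal // s.2 ≠ ⊥ ∧ Continuous s.1 ∧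
    (s.2 ≠ ⊤ → toYW E h (s.1 s.2.toReal).1 (s.1 s.2.toReal).2 ∈ Sv k P δ)}
  have hstep : ∀ s : St, ∃ s' : St, s'.1.1 s.1.2.toReal = s.1.1 s.1.2.toReal ∧
      IsFirstTime {t : ℝ | s.1.2 ≤ t ∧
        Triggers E ha σ p (fun t => (s'.1.1 t).1) (fun t => (s'.1.1 t).2) s.1.2.toReal t ∧
        toYW E h (s'.1.1 t).1 (s'.1.1 t).2 ∈ Sv k P δ \ S2 k P rs} s'.1.2 ∧
      s.1.2 + (g : EReal) ≤ s'.1.2 ∧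
      ∀ t : ℝ, s.1.2 ≤ t → (t : EReal) < s'.1.2 →
        FollowsAt S (fun t => (s'.1.1 t).1) (fun t => (s'.1.1 t).2) t
          (K.law (s.1.1 s.1.2.toReal).1 (s.1.1 s.1.2.toReal).2) := by
    rintro ⟨⟨α, a⟩, hbot, hc, hm⟩
    obtain ⟨α', b, h1, h2, h3, h4, h5⟩ := L.exists_held_piece hgap hbot hm
    exact ⟨⟨(α', b), h3.ne_bot, h2, fun hb => (h3.toReal_mem hb).2.2.1⟩, h1, h3, h4, h5⟩
  choose next hnext using hstep
  let s₀ : St := ⟨(α₀, b₀), hb₀.ne_bot, hα₀c, fun hb => (hb₀.toReal_mem hb).2.1⟩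
  obtain ⟨st, hst0, hst⟩ : ∃ st : ℕ → St, st 0 = s₀ ∧ ∀ n, st (n + 1) = next (st n) :=
    ⟨fun n => next^[n] s₀, rfl, fun n => Function.iterate_succ_apply' _ _ _⟩
  obtain ⟨α, hα⟩ : ∃ α : ℕ → ℝ → Vec k × Vec q, ∀ n, α n = (st n).1.1 := ⟨_, fun _ => rfl⟩
  obtain ⟨τ, hτ0, hτ⟩ : ∃ τ : ℕ → EReal, τ 0 = t₀ ∧ ∀ n, τ (n + 1) = (st n).1.2 :=
    ⟨fun n => Nat.casesOn n (t₀ : EReal) fun n => (st n).1.2, rfl, fun _ => rfl⟩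
  have hmatch : ∀ n, α (n + 1) (τ (n + 1)).toReal = α n (τ (n + 1)).toReal := fun n => by
    rw [hα, hα, hτ, hst]; exact (hnext (st n)).1
  have hfirst : ∀ n, IsFirstTime {t : ℝ | τ (n + 1) ≤ t ∧
      Triggers E ha σ p (fun t => (α (n + 1) t).1) (fun t => (α (n + 1) t).2)
        (τ (n + 1)).toReal t ∧
      toYW E h (α (n + 1) t).1 (α (n + 1) t).2 ∈ Sv k P δ \ S2 k P rs} (τ (n + 1 + 1)) :=
    fun n => by
      rw [hα, hτ, hτ, hst]; exact (hnext (st n)).2.1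
  have hgap' : ∀ i, 1 ≤ i → τ i + (g : EReal) ≤ τ (i + 1) := fun i hi => by
    obtain ⟨n, rfl⟩ := Nat.exists_eq_add_of_le' hi
    rw [hτ, hτ, hst]; exact (hnext (st n)).2.2.1
  have hfol : ∀ n, ∀ t : ℝ, τ (n + 1) ≤ t → (t : EReal) < τ (n + 1 + 1) →
      FollowsAt S (fun t => (α (n + 1) t).1) (fun t => (α (n + 1) t).2) t
        (K.law (α (n + 1) (τ (n + 1)).toReal).1 (α (n + 1) (τ (n + 1)).toReal).2) := fun n => by
    rw [hmatch, hα, hα, hτ, hτ, hst]; exact (hnext (st n)).2.2.2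
  have hα0 : α 0 = α₀ := by rw [hα, hst0]
  have hτ1 : τ 1 = b₀ := by rw [hτ, hst0]
  have hle01 : τ 0 ≤ τ 1 := by
    rw [hτ1, hτ0]
    by_cases hb : b₀ = ⊤
    · rw [hb]; exact le_top
    · rw [← EReal.coe_toReal hb hb₀.ne_bot]
      exact EReal.coe_le_coe_iff.2 (hb₀.toReal_mem hb).1
  have hτbot : ∀ i, τ i ≠ ⊥
    | 0 => by rw [hτ0]; exact EReal.coe_ne_bot t₀
    | i + 1 => by rw [hτ]; exact (st i).2.1
  obtain ⟨x, hx, hxc⟩ := exists_glue hg hτ0 hle01 hτbot hgap'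
    (fun n => by rw [hα]; exact (st n).2.2.1) (fun n _ => hmatch n)
  have hle : ∀ n, τ n ≤ τ (n + 1) := fun n => by
    rcases Nat.eq_zero_or_pos n with rfl | hn
    · exact hle01
    · refine le_trans ?_ (hgap' n hn)
      exact le_add_of_nonneg_right (EReal.coe_nonneg.2 hg.le)
  have hevent : ∀ n, τ n ≠ ⊤ → x (τ n).toReal = α n (τ n).toReal := fun n hn => by
    have := EReal.coe_toReal hn (hτbot n)
    exact hx n _ this.ge (this.le.trans (hle n))
  have hnear : ∀ (n : ℕ) (t : ℝ), τ n ≤ t → (t : EReal) < τ (n + 1) →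
      x =ᶠ[𝓝[Ici t] t] α n := fun n t h1 h2 => by
    filter_upwards [self_mem_nhdsWithin, nhdsWithin_le_nhds
      (continuous_coe_real_ereal.continuousAt.eventually_lt_const h2)] with s hs hs'
    exact hx n s (h1.trans (EReal.coe_le_coe_iff.2 hs)) hs'.le
  have hset : {t : ℝ | t₀ ≤ t ∧ (t : EReal) < ⊤} ⊆ Ici t₀ := fun t ht => ht.1
  have hx0 : x t₀ = (y₀, z₀) := by
    rw [hx 0 t₀ hτ0.le (hτ0 ▸ hle01), hα0, hα₀]
  refine ⟨fun t => (x t).1, fun t => (x t).2, τ, by simp [hx0], by simp [hx0], ?_⟩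
  refine ⟨(hxc.mono hset).fst, (hxc.mono hset).snd, hτ0, ?_, ?_, ?_, ?_, ?_⟩
  · rw [hτ1]
    refine hb₀.congr fun t ht => ?_
    simp only [mem_ofPred_eq, EReal.coe_lt_top, true_and]
    refine and_congr_right fun hat => ?_
    rw [hx 0 t (by rw [hτ0]; exact EReal.coe_le_coe_iff.2 hat) (by rwa [hτ1]), hα0]
  · intro i hi
    obtain ⟨n, rfl⟩ := Nat.exists_eq_add_of_le' hi
    refine (hfirst n).congr fun t ht => ?_
    simp only [mem_ofPred_eq, EReal.coe_lt_top, true_and]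
    refine and_congr_right fun hat => ?_
    have hn : τ (n + 1) ≠ ⊤ := fun hc => by
      rw [hc] at hat; exact not_le.2 (EReal.coe_lt_top t) hat
    simp only [Triggers, hx (n + 1) t hat ht, hevent (n + 1) hn]
  · intro t ht _ ht1
    have hn := hnear 0 t (by rw [hτ0]; exact EReal.coe_le_coe_iff.2 ht) ht1
    rw [hα0] at hn
    exact (hf₀ t ht (by rwa [← hτ1])).congr (hn.fun_comp Prod.fst) (hn.fun_comp Prod.snd)
  · intro i hi t hit _ ht
    obtain ⟨n, rfl⟩ := Nat.exists_eq_add_of_le' hi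
    have hn := hnear (n + 1) t hit ht
    have htop : τ (n + 1) ≠ ⊤ := fun hc => by
      rw [hc] at hit; exact not_le.2 (EReal.coe_lt_top t) hit
    rw [hevent (n + 1) htop]
    exact (hfol n t hit ht).congr (hn.fun_comp Prod.fst) (hn.fun_comp Prod.snd)
  · intro t _ _
    obtain ⟨i, hi⟩ := exists_lt_of_gap hg (hτ0 ▸ hle01) hgap' t
    exact ⟨i + 1, hi⟩

end LoopSetting

end

/-! ### The polynomial approximant and the final assembly -/

theorem continuous_polyMap {k q : ℕ} (H : Fin q → MvPolynomial (Fin k) ℝ) :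
    Continuous (polyMap H) := by
  refine (PiLp.continuous_toLp 2 _).comp (continuous_pi fun j => ?_)
  exact (MvPolynomial.continuous_eval (H j)).comp (by fun_prop)

/-- The neighbourhood filter is not punctured, so the bound holds at `0` itself. -/
theorem eq_zero_of_isBigO_norm_rpow {k q : ℕ} {f : Vec k → Vec q} {s : ℝ} (hs : 0 < s)
    (hf : f =O[𝓝 0] fun y => ‖y‖ ^ s) : f 0 = 0 := by
  obtain ⟨C, hC⟩ := hf.bound
  have := hC.self_of_nhds
  rwa [norm_zero, Real.zero_rpow hs.ne', norm_zero, mul_zero, norm_le_zero_iff] at this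

/-- Since `k > 0` the closed ball has a point of norm exactly `r`, and `S_v` demands norm strictly
below `δ`. -/
theorem lt_of_ballYW_subset_Sv {k q : ℕ} (hk : 0 < k) {P : Matrix (Fin q) (Fin q) ℝ} {δ r : ℝ}
    (hr : 0 ≤ r) (hsub : ballYW k q r ⊆ Sv k P δ) : r < δ := by
  have e : pairNorm (EuclideanSpace.single (⟨0, hk⟩ : Fin k) r) (0 : Vec q) = r := by
    simp [pairNorm, Real.sqrt_sq_eq_abs, abs_of_nonneg hr]
  have hm : ((EuclideanSpace.single (⟨0, hk⟩ : Fin k) r, 0) : Vec k × Vec q) ∈ ballYW k q r :=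
    e.le
  have := (hsub hm).1
  rwa [e] at this

end EventCenter

theorem proposition7 {k q m : ℕ} (hk : 0 < k) (hq : 0 < q)
    (S : EventCenter.Plant k q m) (K : EventCenter.Feedback k q m)
    (hKn : ∀ η : EventCenter.Vec k, EventCenter.act S.B₂ (fderiv ℝ K.Kn 0 η) = 0)
    (hHurwitz : ∀ μ ∈ spectrum ℂ ((EventCenter.AK S K).map (fun a : ℝ => (a : ℂ))), μ.re < 0)
    (E : Matrix (Fin q) (Fin k) ℝ)
    (hE : EventCenter.AK S K * E - E * S.A₁ + S.B₂ * K.K₁₂ = 0)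
    (h : EventCenter.Vec k → EventCenter.Vec q) (ρ : ℝ)
    (hh : EventCenter.IsCenterManifold S K E h ρ)
    (hA₁ : S.A₁ = 0)
    (p : ℝ) (hp : 1 < p) (k₅ k₆ : ℝ) (hk₅ : 0 < k₅) (hk₆ : 0 < k₆)
    (hg_le : ∀ᶠ y in 𝓝 (0 : EventCenter.Vec k),
      ‖EventCenter.reducedG₁ S K E h y‖ ≤ k₅ * ‖y‖ ^ p)
    (hg_inner : ∀ᶠ y in 𝓝 (0 : EventCenter.Vec k),
      inner ℝ y (EventCenter.reducedG₁ S K E h y) ≤ -k₆ * ‖y‖ ^ (p + 1))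
    (H : Fin q → MvPolynomial (Fin k) ℝ) (s : ℝ) (hs : p < s)
    (hH : (fun y => h y - EventCenter.polyMap H y) =O[𝓝 0] fun y => ‖y‖ ^ s)
    (P Q : Matrix (Fin q) (Fin q) ℝ) (hP : P.PosDef) (hQ : Q.PosDef)
    (hLyap : (EventCenter.AK S K).transpose * P + P * EventCenter.AK S K = -Q)
    (sf : ℝ) (hsf : sf ∈ Ioo (0 : ℝ) 1) (σ : ℝ) (hσ : 0 < σ)
    (hσ_le : σ * (2 * EventCenter.opNorm (P * S.B₂ * EventCenter.K1 K E)
        * √(EventCenter.lambdaMax P))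
      ≤ (1 - sf) * EventCenter.lambdaMin Q * √(EventCenter.lambdaMin P)) :
    ∃ δ₀ > 0, ∃ cy > 0, ∃ cw > 0, ∀ δ : ℝ, 0 < δ → δ ≤ δ₀ →
      EventCenter.DecreasesOn S K E h (EventCenter.polyMap H) P σ p cy cw δ ∧
      ∀ rs : ℝ, 0 < rs → EventCenter.ballYW k q rs ⊆ EventCenter.Sv k P δ →
        (∀ (t₀ : ℝ) (y₀ : EventCenter.Vec k) (z₀ : EventCenter.Vec q),
          EventCenter.toYW E h y₀ z₀ ∈ EventCenter.Sv k P δ →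
          ∃ (y : ℝ → EventCenter.Vec k) (z : ℝ → EventCenter.Vec q) (τ : ℕ → EReal),
            y t₀ = y₀ ∧ z t₀ = z₀ ∧
            EventCenter.IsTrajectory S K E h (EventCenter.polyMap H) σ p
              (EventCenter.Sv k P δ \ EventCenter.S2 k P rs) t₀ ⊤ y z τ) ∧
        ∃ Tb : ℝ, 0 ≤ Tb ∧ ∃ τmin : ℝ, 0 < τmin ∧
          ∀ (t₀ : ℝ) (T : EReal) (y : ℝ → EventCenter.Vec k) (z : ℝ → EventCenter.Vec q)
            (τ : ℕ → EReal),
            EventCenter.IsTrajectory S K E h (EventCenter.polyMap H) σ p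
              (EventCenter.Sv k P δ \ EventCenter.S2 k P rs) t₀ T y z τ →
            EventCenter.toYW E h (y t₀) (z t₀) ∈ EventCenter.Sv k P δ →
            (∀ t : ℝ, t₀ ≤ t → (t : EReal) < T →
              EventCenter.toYW E h (y t) (z t) ∈ EventCenter.Sv k P δ) ∧
            (∀ t : ℝ, t₀ + Tb ≤ t → (t : EReal) < T →
              EventCenter.toYW E h (y t) (z t) ∈ EventCenter.ballYW k q rs) ∧
            (∀ i : ℕ, 1 ≤ i → τ i + (τmin : EReal) ≤ τ (i + 1)) := by
  have hp0 : 0 < p := by linarith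
  obtain ⟨δ₁, hδ₁, cy, hcy, cw, hcw, hdec⟩ := EventCenter.exists_decreasesOn hq S K hKn E hE hh hA₁
    hp0 hk₆ hg_le hg_inner hs hH hP hQ hLyap hsf.1 hσ hσ_le
  have hρ := hh.radius_pos
  have ha0 : EventCenter.polyMap H 0 = 0 := by
    have := EventCenter.eq_zero_of_isBigO_norm_rpow (hp0.trans hs) hH
    rwa [hh.zero, zero_sub, neg_eq_zero] at this
  -- Halving `ρ` makes `δ < ρ` strict, so the closed `δ`-ball lies in the domain of `h`.
  refine ⟨min δ₁ (ρ / 2), by positivity, cy, hcy, cw, hcw, fun δ hδ hδle => ?_⟩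
  have hdecδ := hdec.mono (hδle.trans (min_le_left _ _))
  refine ⟨hdecδ, fun rs hrs hsub => ?_⟩
  have L : EventCenter.LoopSetting S K E h (EventCenter.polyMap H) P σ p cy cw δ rs ρ :=
    { q_pos := hq
      manifold := hh
      approx_cont := EventCenter.continuous_polyMap H
      approx_zero := ha0
      posDef := hP
      σ_pos := hσ
      p_pos := hp0
      cy_pos := hcy
      cw_pos := hcw
      δ_pos := hδ
      δ_lt := by linarith [hδle.trans (min_le_right _ _)]
      decreases := hdecδ
      rs_pos := hrs
      rs_lt := EventCenter.lt_of_ballYW_subset_Sv hk hrs.le hsub }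
  exact ⟨fun t₀ y₀ z₀ h₀ => L.exists_trajectory t₀ y₀ z₀ h₀, L.exists_uniform_bounds⟩
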